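/- Let $\sigma>0$ be known and let $f_\theta(y)=\frac{1}{\sqrt{2\pi\sigma^2}}\exp\left(-\frac{(y-\theta)^2}{2\sigma^2}\right)$, for $y,\theta\in\mathbb R$, be the Gaussian likelihood. Let $\pi$ be a positive Radon measure on $\mathbb R$ (the prior, possibly improper) that is not concentrated at a single point and satisfies $0<f(y)<\infty$ for all $y\in\mathbb R$, where $f(y)=\int_{\mathbb R} f_\theta(y)\,\pi(d\theta)$ is the marginal likelihood. For $\alpha\in(0,1)$ and $\theta_0\in\mathbb R$ put $\lambda_{\theta_0}(y)=\log f(y)-\log f_{\theta_0}(y)$, let $k_\alpha(\theta_0)$ be the smallest $k$ such that $\Pr(\lambda_{\theta_0}(Y)\le k\mid\theta=\theta_0)=1-\alpha$, where $Y\mid\theta=\theta_0\sim\mathcal N(\theta_0,\sigma^2)$, and let $$A_\alpha(\theta_0)=\{y:\lambda_{\theta_0}(y)\le k_\alpha(\theta_0)\},\qquad C_\alpha(y)=\{\theta_0: y\in A_\alpha(\theta_0)\}$$ be the acceptance regions and the FAB confidence regions. The focal point $\widehat\theta^{\mathrm{FAB}}(y)$ is the unique element of $\bigcap_{\alpha\in(0,1)}C_\alpha(y)$,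 defined when this intersection is a singleton and $\mathrm{vol}(C_\alpha(y))\to0$ as $\alpha\to1$. Let $\Phi$ and $\Phi^{-1}$ be the standard normal distribution function and its quantile function, and for $\omega\in(0,1)$ let $$g_\alpha(\omega)=\Phi^{-1}(\alpha\omega)-\Phi^{-1}(\alpha(1-\omega)).$$ **Theorem.** Suppose that $$f(y)\sim\gamma|y|^{-\delta}\exp\left(-\frac{\kappa}{\sigma}|y|\right)\quad\text{as } y\to\infty \text{ and as } y\to-\infty,$$ for some $\gamma>0$, $\delta\ge0$, $\kappa\ge0$, and that the derivative of $f(y)\exp(\kappa|y|/\sigma)$, defined on $\mathbb R\setminus\{0\}$, is ultimately monotone as $y\to\infty$ and as $y\to-\infty$. Let $\alpha\in(0,1)$. Then: 1. The value $k_\alpha(\theta_0)$ exists for every $\theta_0\in\mathbb R$, the region $C_\alpha(y)$ is closed for every $y\in\mathbb R$, and $\sup_{y\in\mathbb R}\mathrm{vol}(C_\alpha(y))<\infty$. 2. The function $g_\alpha$ is a strictly increasing bijection from $(0,1)$ onto $\mathbb R$, and $c_\alpha:=g_\alpha^{-1}(-2\kappa)$ satisfies $0<c_\alpha\le\Phi(-\kappa)$,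 with $c_\alpha<\Phi(-\kappa)$ if $\kappa>0$. 3. With respect to the Hausdorff distance on closed subsets of $\mathbb R$, $$\lim_{y\to\infty}\bigl(C_\alpha(y)-y\bigr)=\left[-\sigma\Phi^{-1}(1-\alpha c_\alpha),\ \sigma\Phi^{-1}(1-\alpha(1-c_\alpha))\right],$$ $$\lim_{y\to-\infty}\bigl(C_\alpha(y)-y\bigr)=\left[-\sigma\Phi^{-1}(1-\alpha(1-c_\alpha)),\ \sigma\Phi^{-1}(1-\alpha c_\alpha)\right].$$ 4. For every $y\in\mathbb R$ the focal point $\widehat\theta^{\mathrm{FAB}}(y)$ exists and equals the posterior mean $\frac{1}{f(y)}\int_{\mathbb R}\theta f_\theta(y)\,\pi(d\theta)$, and $$\lim_{y\to\infty}\bigl(y-\widehat\theta^{\mathrm{FAB}}(y)\bigr)=\lim_{y\to-\infty}\bigl(\widehat\theta^{\mathrm{FAB}}(y)-y\bigr)=\sigma\kappa.$$ -/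

import Mathlib

open MeasureTheory ProbabilityTheory Set Filter Topology
open scoped NNReal ENNReal

noncomputable section

/-- The variance `σ²` as a nonnegative real. -/
def fabVar (σ : ℝ) : ℝ≥0 := ⟨σ ^ 2, sq_nonneg σ⟩

/-- The likelihood `f_θ(y)`: the density at `y` of the normal law with mean `θ` and variance `σ²`. -/
def fabLikelihood (σ θ y : ℝ) : ℝ := gaussianPDFReal θ (fabVar σ) y

/-- The standing assumption on the prior: a positive Radon (on `ℝ`: locally finite Borel) measure
that is not concentrated at one point, with `0 < ∫ f_θ(y) π(dθ) < ∞` for every `y`. -/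
structure FabAdmissiblePrior (σ : ℝ) (prior : Measure ℝ) : Prop where
  locallyFinite : IsLocallyFiniteMeasure prior
  nondegenerate : ∀ θ₁ : ℝ, prior {θ₁}ᶜ ≠ 0
  marginal_pos : ∀ y : ℝ, 0 < ∫⁻ θ, ENNReal.ofReal (fabLikelihood σ θ y) ∂prior
  marginal_lt_top : ∀ y : ℝ, ∫⁻ θ, ENNReal.ofReal (fabLikelihood σ θ y) ∂prior < ⊤

/-- The marginal likelihood `f(y) = ∫ f_θ(y) π(dθ)`. -/
def fabMarginal (σ : ℝ) (prior : Measure ℝ) (y : ℝ) : ℝ :=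
  ∫ θ, fabLikelihood σ θ y ∂prior

/-- The posterior mean `E[θ | y] = ∫ θ f_θ(y) π(dθ) / f(y)`. -/
def fabPosteriorMean (σ : ℝ) (prior : Measure ℝ) (y : ℝ) : ℝ :=
  (∫ θ, θ * fabLikelihood σ θ y ∂prior) / fabMarginal σ prior y

/-- The log-likelihood ratio `λ_{θ₀}(y) = log f(y) - log f_{θ₀}(y)`. -/
def fabLogRatio (σ : ℝ) (prior : Measure ℝ) (θ₀ y : ℝ) : ℝ :=
  Real.log (fabMarginal σ prior y) - Real.log (fabLikelihood σ θ₀ y)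

/-- The levels `k` for which the test of `θ = θ₀` that accepts on `{y | λ_{θ₀}(y) ≤ k}` has
acceptance probability exactly `1 - α` under `θ₀`. -/
def fabExactLevels (σ : ℝ) (prior : Measure ℝ) (α θ₀ : ℝ) : Set ℝ :=
  {k | gaussianReal θ₀ (fabVar σ) {y | fabLogRatio σ prior θ₀ y ≤ k} = ENNReal.ofReal (1 - α)}

/-- The critical value `k_α(θ₀)`, the smallest exact level. -/
def fabCritical (σ : ℝ) (prior : Measure ℝ) (α θ₀ : ℝ) : ℝ :=
  sInf (fabExactLevels σ prior α θ₀)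

/-- The acceptance region `A_α(θ₀)` of the most powerful test. -/
def fabAcceptance (σ : ℝ) (prior : Measure ℝ) (α θ₀ : ℝ) : Set ℝ :=
  {y | fabLogRatio σ prior θ₀ y ≤ fabCritical σ prior α θ₀}

/-- The FAB confidence region `C_α(y)`, by inversion of the acceptance regions. -/
def fabRegion (σ : ℝ) (prior : Measure ℝ) (α y : ℝ) : Set ℝ :=
  {θ₀ | y ∈ fabAcceptance σ prior α θ₀}

/-- The recentred region `C_α(y) - y`. -/
def fabCenteredRegion (σ : ℝ) (prior : Measure ℝ) (α y : ℝ) : Set ℝ :=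
  (fun θ₀ => θ₀ - y) '' fabRegion σ prior α y

/-- `t` is the focal point of the nested regions `C_α(y)`, `α ∈ (0,1)`: their volume tends to `0`
as `α → 1`, and `t` is the only point common to all of them. -/
def IsFabFocalPoint (σ : ℝ) (prior : Measure ℝ) (y t : ℝ) : Prop :=
  Tendsto (fun α => volume (fabRegion σ prior α y)) (𝓝[<] 1) (𝓝 0) ∧
    ⋂ α ∈ Ioo (0 : ℝ) 1, fabRegion σ prior α y = {t}

/-- The standard normal distribution function `Φ`. -/
def stdNormalCdf (x : ℝ) : ℝ := cdf (gaussianReal 0 1) x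

/-- The standard normal quantile function `Φ⁻¹` (meaningful on `(0,1)`). -/
def stdNormalQuantile (p : ℝ) : ℝ := sInf {x | p ≤ stdNormalCdf x}

/-- `g_α(ω) = Φ⁻¹(αω) - Φ⁻¹(α(1-ω))`. -/
def fabG (α ω : ℝ) : ℝ := stdNormalQuantile (α * ω) - stdNormalQuantile (α * (1 - ω))

/-- `c_α = g_α⁻¹(-2κ)`, where `g_α⁻¹` is the inverse of `g_α` on `(0,1)`. -/
def fabLimitWeight (α κ : ℝ) : ℝ := Function.invFunOn (fabG α) (Ioo 0 1) (-2 * κ)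

end

/-! Up to a constant, `λ_θ(y)` is `L(y) + (y - θ)²/(2σ²)` with `L = log f`, and `L(y) + y²/(2σ²)` is
the log-Laplace transform of the prior tilted by `f_θ(0)`, taken at `y/σ²`. The prior is not a point
mass, so this is strictly convex, and its tangents are governed by the posterior mean (Tweedie).
Hence `λ_θ` is strictly convex in `y`, and each acceptance region is an interval with equal ratio at
its two ends. The interval is coded by one number, the share `ω` of `α` spent in the left tail.

Far out, only increments of `L` matter, and they tend to those of a linear function of slope `∓κ/σ`.
For a fixed `ω` the imbalance between the two ends then tends to a positive factor times `g_α(ω) ∓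
2κ`, so the balanced weight tends to `1 - c_α` at `+∞` and to `c_α` at `-∞`
(`tendsto_weight_of_tail`). The weight is also continuous in `θ`, so the interval ends are
continuous and bounded. Inverting the intervals gives closed, uniformly bounded regions and the
Hausdorff limits (`tendsto_hausdorffEDist_inverted_interval`).

A point `θ` survives in every region exactly when `y` minimises `λ_θ`, that is, when `θ` is the
posterior mean (`iInter_fabRegion`). Its offset from `y` is read off the slope of `L`, which
convexity controls by increments (`tendsto_mean_sub`). The bound `c_α ≤ Φ(-κ)` comes from
log-concavity of `Φ`. -/

noncomputable section

/-! ### The standard normal distribution function -/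

lemma gaussianReal_zero_one_Icc {a b : ℝ} :
    gaussianReal 0 1 (Icc a b) = ENNReal.ofReal (stdNormalCdf b - stdNormalCdf a) := by
  have h1 : (1 : ℝ≥0) ≠ 0 := one_ne_zero
  have := nullSingletonClass_gaussianReal (μ := 0) h1
  rw [← measure_congr (Ioc_ae_eq_Icc (μ := gaussianReal 0 1) (a := a) (b := b))]
  conv_lhs => rw [← measure_cdf (gaussianReal 0 1)]
  rw [StieltjesFunction.measure_Ioc]
  rfl

lemma fabVar_ne_zero {σ : ℝ} (hσ : 0 < σ) : fabVar σ ≠ 0 := by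
  intro h
  have : ((fabVar σ : ℝ≥0) : ℝ) = 0 := by rw [h]; rfl
  exact (pow_pos hσ 2).ne' this

lemma gaussianReal_fabVar_eq_map (σ θ : ℝ) :
    gaussianReal θ (fabVar σ) = (gaussianReal 0 1).map (fun z => θ + σ * z) := by
  have h : (fun z : ℝ => θ + σ * z) = (fun z => θ + z) ∘ (fun z => σ * z) := rfl
  rw [h, ← Measure.map_map (by fun_prop) (by fun_prop), gaussianReal_map_const_mul,
    gaussianReal_map_const_add]
  congr 1
  · ring
  · rw [mul_one]; rfl

lemma gaussianReal_fabVar_Icc {σ : ℝ} (hσ : 0 < σ) (θ a b : ℝ) :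
    gaussianReal θ (fabVar σ) (Icc (θ + σ * a) (θ + σ * b)) =
      ENNReal.ofReal (stdNormalCdf b - stdNormalCdf a) := by
  rw [gaussianReal_fabVar_eq_map, Measure.map_apply (by fun_prop) measurableSet_Icc,
    ← gaussianReal_zero_one_Icc]
  congr 1
  ext z
  simp [mul_le_mul_iff_right₀ hσ]

lemma hasDerivAt_stdNormalCdf (x : ℝ) :
    HasDerivAt stdNormalCdf (gaussianPDFReal 0 1 x) x := by
  have h1 : (1 : ℝ≥0) ≠ 0 := one_ne_zero
  have hI := integrable_gaussianPDFReal 0 1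
  have hc : Continuous (gaussianPDFReal 0 1) := by
    unfold gaussianPDFReal; fun_prop
  have hF : ∀ z, stdNormalCdf z = ∫ t in Iic z, gaussianPDFReal 0 1 t := by
    intro z
    unfold stdNormalCdf
    rw [cdf_eq_real, measureReal_def, gaussianReal_apply_eq_integral _ h1, ENNReal.toReal_ofReal]
    exact integral_nonneg fun t => gaussianPDFReal_nonneg _ _ _
  have hG : stdNormalCdf =
      fun z => stdNormalCdf 0 + ∫ t in (0 : ℝ)..z, gaussianPDFReal 0 1 t := by
    funext z
    rw [← intervalIntegral.integral_Iic_sub_Iic hI.integrableOn hI.integrableOn, hF, hF]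
    ring
  rw [hG]
  exact (intervalIntegral.integral_hasDerivAt_right (hc.intervalIntegrable _ _)
    (hc.stronglyMeasurableAtFilter _ _) hc.continuousAt).const_add _

lemma continuous_stdNormalCdf : Continuous stdNormalCdf :=
  continuous_iff_continuousAt.2 fun x => (hasDerivAt_stdNormalCdf x).continuousAt

lemma strictMono_stdNormalCdf : StrictMono stdNormalCdf := by
  refine strictMono_of_deriv_pos fun x => ?_
  rw [(hasDerivAt_stdNormalCdf x).deriv]
  exact gaussianPDFReal_pos _ _ _ one_ne_zero

lemma tendsto_stdNormalCdf_atTop : Tendsto stdNormalCdf atTop (𝓝 1) :=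
  tendsto_cdf_atTop _

lemma tendsto_stdNormalCdf_atBot : Tendsto stdNormalCdf atBot (𝓝 0) :=
  tendsto_cdf_atBot _

lemma stdNormalCdf_pos (x : ℝ) : 0 < stdNormalCdf x :=
  (cdf_nonneg _ (x - 1)).trans_lt (strictMono_stdNormalCdf (sub_one_lt x))

lemma stdNormalCdf_neg (x : ℝ) : stdNormalCdf (-x) = 1 - stdNormalCdf x := by
  have hd : ∀ z, HasDerivAt (fun z => stdNormalCdf (-z) + stdNormalCdf z) 0 z := by
    intro z
    have h1 := (hasDerivAt_stdNormalCdf (-z)).comp z (hasDerivAt_neg z)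
    have h2 := h1.add (hasDerivAt_stdNormalCdf z)
    have h3 : gaussianPDFReal 0 1 (-z) * -1 + gaussianPDFReal 0 1 z = 0 := by
      simp [gaussianPDFReal]
    rw [h3] at h2
    exact h2
  have hconst : ∀ z, stdNormalCdf (-z) + stdNormalCdf z = stdNormalCdf (-x) + stdNormalCdf x :=
    fun z => is_const_of_deriv_eq_zero (fun z => (hd z).differentiableAt)
      (fun z => (hd z).deriv) z x
  have hlim : Tendsto (fun z => stdNormalCdf (-z) + stdNormalCdf z) atTop (𝓝 (0 + 1)) :=
    (tendsto_stdNormalCdf_atBot.comp tendsto_neg_atTop_atBot).add tendsto_stdNormalCdf_atTop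
  have := tendsto_nhds_unique (hlim.congr hconst) tendsto_const_nhds
  linarith

/-! ### The standard normal quantile function -/

lemma stdNormalQuantile_stdNormalCdf (x : ℝ) : stdNormalQuantile (stdNormalCdf x) = x := by
  have : {z | stdNormalCdf x ≤ stdNormalCdf z} = Ici x := by
    ext z
    exact strictMono_stdNormalCdf.le_iff_le
  rw [stdNormalQuantile, this, csInf_Ici]

lemma exists_stdNormalCdf_eq {p : ℝ} (hp : p ∈ Ioo (0 : ℝ) 1) : ∃ x, stdNormalCdf x = p := by
  obtain ⟨a, ha⟩ := (tendsto_stdNormalCdf_atBot.eventually_lt_const hp.1).exists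
  obtain ⟨b, hb⟩ := (tendsto_stdNormalCdf_atTop.eventually_const_lt hp.2).exists
  exact mem_range_of_exists_le_of_exists_ge continuous_stdNormalCdf ⟨a, ha.le⟩ ⟨b, hb.le⟩

lemma stdNormalCdf_stdNormalQuantile {p : ℝ} (hp : p ∈ Ioo (0 : ℝ) 1) :
    stdNormalCdf (stdNormalQuantile p) = p := by
  obtain ⟨x, rfl⟩ := exists_stdNormalCdf_eq hp
  rw [stdNormalQuantile_stdNormalCdf]

lemma stdNormalQuantile_lt_iff {p x : ℝ} (hp : p ∈ Ioo (0 : ℝ) 1) :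
    stdNormalQuantile p < x ↔ p < stdNormalCdf x := by
  rw [← strictMono_stdNormalCdf.lt_iff_lt, stdNormalCdf_stdNormalQuantile hp]

lemma lt_stdNormalQuantile_iff {p x : ℝ} (hp : p ∈ Ioo (0 : ℝ) 1) :
    x < stdNormalQuantile p ↔ stdNormalCdf x < p := by
  rw [← strictMono_stdNormalCdf.lt_iff_lt, stdNormalCdf_stdNormalQuantile hp]

lemma strictMonoOn_stdNormalQuantile : StrictMonoOn stdNormalQuantile (Ioo 0 1) := by
  intro p hp q hq hpq
  rwa [stdNormalQuantile_lt_iff hp, stdNormalCdf_stdNormalQuantile hq]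

lemma continuousOn_stdNormalQuantile : ContinuousOn stdNormalQuantile (Ioo 0 1) := by
  intro p hp
  refine ContinuousAt.continuousWithinAt (tendsto_order.2 ⟨fun a ha => ?_, fun a ha => ?_⟩)
  · rw [lt_stdNormalQuantile_iff hp] at ha
    filter_upwards [Ioo_mem_nhds hp.1 hp.2, eventually_gt_nhds ha] with q hq hq'
    rwa [lt_stdNormalQuantile_iff hq]
  · rw [gt_iff_lt, stdNormalQuantile_lt_iff hp] at ha
    filter_upwards [Ioo_mem_nhds hp.1 hp.2, eventually_lt_nhds ha] with q hq hq'
    rwa [stdNormalQuantile_lt_iff hq]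

lemma stdNormalQuantile_one_sub {p : ℝ} (hp : p ∈ Ioo (0 : ℝ) 1) :
    stdNormalQuantile (1 - p) = -stdNormalQuantile p := by
  conv_lhs => rw [← stdNormalCdf_stdNormalQuantile hp, ← stdNormalCdf_neg,
    stdNormalQuantile_stdNormalCdf]

lemma tendsto_stdNormalQuantile_zero : Tendsto stdNormalQuantile (𝓝[>] 0) atBot := by
  refine tendsto_atBot.2 fun b => ?_
  filter_upwards [Ioo_mem_nhdsGT (zero_lt_one' ℝ), Ioo_mem_nhdsGT (stdNormalCdf_pos b)]
    with p hp hp'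
  exact ((stdNormalQuantile_lt_iff hp).2 hp'.2).le

/-! ### The weight function -/

lemma mul_mem_Ioo_zero_one {α ω : ℝ} (hα : α ∈ Ioo (0 : ℝ) 1) (hω : ω ∈ Ioo (0 : ℝ) 1) :
    α * ω ∈ Ioo (0 : ℝ) 1 :=
  ⟨mul_pos hα.1 hω.1, mul_lt_one_of_nonneg_of_lt_one_left hα.1.le hα.2 hω.2.le⟩

lemma one_sub_mem_Ioo {ω : ℝ} (hω : ω ∈ Ioo (0 : ℝ) 1) : 1 - ω ∈ Ioo (0 : ℝ) 1 :=
  ⟨sub_pos.2 hω.2, sub_lt_self _ hω.1⟩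

lemma fabG_one_sub (α ω : ℝ) : fabG α (1 - ω) = -fabG α ω := by
  unfold fabG
  rw [sub_sub_cancel]
  ring

lemma strictMonoOn_stdNormalQuantile_mul {α : ℝ} (hα : α ∈ Ioo (0 : ℝ) 1) :
    StrictMonoOn (fun ω => stdNormalQuantile (α * ω)) (Ioo 0 1) := fun _ hx _ hy hxy =>
  strictMonoOn_stdNormalQuantile (mul_mem_Ioo_zero_one hα hx) (mul_mem_Ioo_zero_one hα hy)
    (mul_lt_mul_of_pos_left hxy hα.1)

lemma continuousOn_stdNormalQuantile_mul {α : ℝ} (hα : α ∈ Ioo (0 : ℝ) 1) :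
    ContinuousOn (fun ω => stdNormalQuantile (α * ω)) (Ioo 0 1) :=
  continuousOn_stdNormalQuantile.comp (by fun_prop) fun _ hω => mul_mem_Ioo_zero_one hα hω

lemma continuousOn_stdNormalQuantile_mul_one_sub {α : ℝ} (hα : α ∈ Ioo (0 : ℝ) 1) :
    ContinuousOn (fun ω => stdNormalQuantile (α * (1 - ω))) (Ioo 0 1) :=
  (continuousOn_stdNormalQuantile_mul hα).comp (by fun_prop) fun _ hω => one_sub_mem_Ioo hω

lemma tendsto_stdNormalQuantile_mul_zero {α : ℝ} (hα : α ∈ Ioo (0 : ℝ) 1) :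
    Tendsto (fun ω => stdNormalQuantile (α * ω)) (𝓝[>] 0) atBot := by
  refine tendsto_stdNormalQuantile_zero.comp (tendsto_nhdsWithin_iff.2 ⟨?_, ?_⟩)
  · have : Tendsto (fun ω : ℝ => α * ω) (𝓝 0) (𝓝 (α * 0)) :=
      (continuous_const_mul α).tendsto 0
    rw [mul_zero] at this
    exact this.mono_left nhdsWithin_le_nhds
  · filter_upwards [self_mem_nhdsWithin] with ω hω using mul_pos hα.1 hω

lemma tendsto_stdNormalQuantile_mul_one_sub_zero {α : ℝ} (hα : α ∈ Ioo (0 : ℝ) 1) :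
    Tendsto (fun ω => stdNormalQuantile (α * (1 - ω))) (𝓝[>] 0) (𝓝 (stdNormalQuantile α)) := by
  have h1 : ContinuousAt stdNormalQuantile (α * (1 - 0)) := by
    rw [sub_zero, mul_one]
    exact continuousOn_stdNormalQuantile.continuousAt (Ioo_mem_nhds hα.1 hα.2)
  have h2 : ContinuousAt (fun ω : ℝ => stdNormalQuantile (α * (1 - ω))) 0 :=
    ContinuousAt.comp (f := fun ω : ℝ => α * (1 - ω)) h1 (by fun_prop)
  have h3 := h2.tendsto
  simp only [sub_zero, mul_one] at h3
  exact h3.mono_left nhdsWithin_le_nhds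

lemma strictMonoOn_fabG {α : ℝ} (hα : α ∈ Ioo (0 : ℝ) 1) : StrictMonoOn (fabG α) (Ioo 0 1) := by
  intro x hx y hy hxy
  have h1 := strictMonoOn_stdNormalQuantile_mul hα hx hy hxy
  have h2 := strictMonoOn_stdNormalQuantile_mul hα (one_sub_mem_Ioo hy) (one_sub_mem_Ioo hx)
    (sub_lt_sub_left hxy 1)
  simp only [fabG]
  linarith

lemma continuousOn_fabG {α : ℝ} (hα : α ∈ Ioo (0 : ℝ) 1) : ContinuousOn (fabG α) (Ioo 0 1) :=
  (continuousOn_stdNormalQuantile_mul hα).sub (continuousOn_stdNormalQuantile_mul_one_sub hα)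

lemma tendsto_fabG_zero {α : ℝ} (hα : α ∈ Ioo (0 : ℝ) 1) :
    Tendsto (fabG α) (𝓝[>] 0) atBot := by
  have h := (tendsto_stdNormalQuantile_mul_zero hα).atBot_add
    (tendsto_stdNormalQuantile_mul_one_sub_zero hα).neg
  exact h.congr fun ω => (sub_eq_add_neg _ _).symm

lemma bijOn_fabG {α : ℝ} (hα : α ∈ Ioo (0 : ℝ) 1) : BijOn (fabG α) (Ioo 0 1) univ := by
  refine ⟨mapsTo_univ _ _, (strictMonoOn_fabG hα).injOn, fun v _ => ?_⟩
  have hunit : ∀ᶠ ω in 𝓝[>] (0 : ℝ), ω ∈ Ioo (0 : ℝ) 1 := Ioo_mem_nhdsGT (zero_lt_one' ℝ)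
  -- The antisymmetry `fabG_one_sub` turns small values near `0` into large values near `1`, so the
  -- limit at `0` suffices for both ends.
  have hlow : ∀ v, ∃ ω ∈ Ioo (0 : ℝ) 1, fabG α ω ≤ v := fun v =>
    (hunit.and ((tendsto_fabG_zero hα).eventually_le_atBot v)).exists
  obtain ⟨a, ha, hav⟩ := hlow v
  obtain ⟨b, hb, hbv⟩ := hlow (-v)
  refine isPreconnected_Ioo.intermediate_value ha (one_sub_mem_Ioo hb) (continuousOn_fabG hα)
    ⟨hav, ?_⟩
  rw [fabG_one_sub]
  linarith

lemma fabLimitWeight_mem {α : ℝ} (hα : α ∈ Ioo (0 : ℝ) 1) (κ : ℝ) :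
    fabLimitWeight α κ ∈ Ioo (0 : ℝ) 1 :=
  Function.invFunOn_mem ((bijOn_fabG hα).surjOn (mem_univ (-2 * κ)))

lemma fabG_fabLimitWeight {α : ℝ} (hα : α ∈ Ioo (0 : ℝ) 1) (κ : ℝ) :
    fabG α (fabLimitWeight α κ) = -2 * κ :=
  Function.invFunOn_eq ((bijOn_fabG hα).surjOn (mem_univ (-2 * κ)))

/-- Strict log-concavity of `Φ`: the ratio `Φ(x - s) / Φ(x)` is strictly increasing in `x`. -/
lemma stdNormalCdf_mul_lt_mul {x y s : ℝ} (hs : 0 < s) (hxy : x < y) :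
    stdNormalCdf (x - s) * stdNormalCdf y < stdNormalCdf (y - s) * stdNormalCdf x := by
  -- `r` is the density ratio `φ(x - s)/φ(x)`, so `Q` has its critical point at `x`: it increases
  -- from its limit `0` up to `x`, then decreases. Thus `Φ(x - s) < r Φ(x)` and `r (Φ(y) - Φ(x)) ≤
  -- Φ(y - s) - Φ(x - s)`, and `r` is eliminated between the two.
  set r := Real.exp (s * x - s ^ 2 / 2) with hr
  set Q : ℝ → ℝ := fun t => r * stdNormalCdf t - stdNormalCdf (t - s) with hQ
  have hpdf : ∀ t, gaussianPDFReal 0 1 (t - s) =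
      gaussianPDFReal 0 1 t * Real.exp (s * t - s ^ 2 / 2) := by
    intro t
    simp only [gaussianPDFReal]
    rw [mul_assoc (√(2 * Real.pi * ((1 : ℝ≥0) : ℝ)))⁻¹, ← Real.exp_add]
    refine congrArg (fun e => (√(2 * Real.pi * ((1 : ℝ≥0) : ℝ)))⁻¹ * Real.exp e) ?_
    simp only [NNReal.coe_one]
    ring
  have hd : ∀ t, HasDerivAt Q
      (gaussianPDFReal 0 1 t * (r - Real.exp (s * t - s ^ 2 / 2))) t := by
    intro t
    have h := ((hasDerivAt_stdNormalCdf t).const_mul r).sub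
      ((hasDerivAt_stdNormalCdf (t - s)).comp_sub_const t s)
    rw [hpdf] at h
    exact h.congr_deriv (by ring)
  have hQc : Continuous Q := continuous_iff_continuousAt.2 fun t => (hd t).continuousAt
  have hpos : ∀ t, 0 < gaussianPDFReal 0 1 t := fun t => gaussianPDFReal_pos _ _ _ one_ne_zero
  have hmono : StrictMonoOn Q (Iic x) := by
    refine strictMonoOn_of_deriv_pos (convex_Iic x) hQc.continuousOn fun t ht => ?_
    rw [interior_Iic, mem_Iio] at ht
    rw [(hd t).deriv]
    refine mul_pos (hpos t) (sub_pos.2 (Real.exp_lt_exp.2 ?_))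
    have := mul_lt_mul_of_pos_left ht hs
    linarith
  have hanti : AntitoneOn Q (Ici x) := by
    refine antitoneOn_of_deriv_nonpos (convex_Ici x) hQc.continuousOn
      (fun t _ => (hd t).differentiableAt.differentiableWithinAt) fun t ht => ?_
    rw [interior_Ici, mem_Ioi] at ht
    rw [(hd t).deriv]
    refine mul_nonpos_of_nonneg_of_nonpos (hpos t).le (sub_nonpos.2 (Real.exp_le_exp.2 ?_))
    have := mul_lt_mul_of_pos_left ht hs
    linarith
  have hlim : Tendsto Q atBot (𝓝 (r * 0 - 0)) :=
    (tendsto_stdNormalCdf_atBot.const_mul r).sub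
      (tendsto_stdNormalCdf_atBot.comp (tendsto_atBot_add_const_right _ (-s) tendsto_id))
  rw [mul_zero, sub_zero] at hlim
  -- The limit at `-∞` only gives a weak inequality; stopping one unit short of `x` leaves room for
  -- a strict one at `x`.
  have hx1 : 0 ≤ Q (x - 1) := by
    refine le_of_tendsto hlim ?_
    filter_upwards [eventually_le_atBot (x - 1)] with t ht
    exact hmono.monotoneOn (mem_Iic.2 (by linarith)) (mem_Iic.2 (by linarith)) ht
  have hx : 0 < Q x := hx1.trans_lt
    (hmono (mem_Iic.2 (by linarith)) (mem_Iic.2 le_rfl) (by linarith))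
  have hyx : Q y ≤ Q x := hanti (mem_Ici.2 le_rfl) (mem_Ici.2 hxy.le) hxy.le
  have hlt := strictMono_stdNormalCdf hxy
  have hp := stdNormalCdf_pos x
  simp only [hQ] at hx hyx
  nlinarith

lemma fabLimitWeight_zero {α : ℝ} (hα : α ∈ Ioo (0 : ℝ) 1) : fabLimitWeight α 0 = 1 / 2 := by
  refine (strictMonoOn_fabG hα).injOn (fabLimitWeight_mem hα 0) (by norm_num) ?_
  rw [fabG_fabLimitWeight hα, fabG]
  norm_num

/-- With `u = Φ⁻¹(αc)`, the equation for `c` gives `c/(1 - c) = Φ(u)/Φ(u + 2κ)`. Such ratios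
increase with `u`, and at `u = -κ` the ratio is `Φ(-κ)/(1 - Φ(-κ))`. -/
lemma fabLimitWeight_lt {α κ : ℝ} (hα : α ∈ Ioo (0 : ℝ) 1) (hκ : 0 < κ) :
    fabLimitWeight α κ < stdNormalCdf (-κ) := by
  have hc := fabLimitWeight_mem hα κ
  have hg := fabG_fabLimitWeight hα κ
  set c := fabLimitWeight α κ
  have h1 := stdNormalCdf_stdNormalQuantile (mul_mem_Ioo_zero_one hα hc)
  have h2 := stdNormalCdf_stdNormalQuantile (mul_mem_Ioo_zero_one hα (one_sub_mem_Ioo hc))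
  unfold fabG at hg
  set u := stdNormalQuantile (α * c)
  rw [show stdNormalQuantile (α * (1 - c)) = u + 2 * κ by linarith] at h2
  have hκ' := stdNormalCdf_neg κ
  -- Otherwise `Φ(u) + Φ(u + 2κ) ≥ Φ(-κ) + Φ(κ) = 1`, whereas this sum is `αc + α(1 - c) = α < 1`.
  have hu : u < -κ := by
    by_contra! h
    have h3 := strictMono_stdNormalCdf.monotone h
    have h4 := strictMono_stdNormalCdf.monotone (show κ ≤ u + 2 * κ by linarith)
    have := hα.2
    nlinarith
  have key := stdNormalCdf_mul_lt_mul (x := -κ) (y := κ) (s := -κ - u) (by linarith) (by linarith)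
  rw [show -κ - (-κ - u) = u by ring, show κ - (-κ - u) = u + 2 * κ by ring, h1, h2,
    show stdNormalCdf κ = 1 - stdNormalCdf (-κ) by linarith] at key
  have := hα.1
  by_contra! h
  nlinarith

lemma fabLimitWeight_le {α κ : ℝ} (hα : α ∈ Ioo (0 : ℝ) 1) (hκ : 0 ≤ κ) :
    fabLimitWeight α κ ≤ stdNormalCdf (-κ) := by
  rcases hκ.eq_or_lt with rfl | h
  · have := stdNormalCdf_neg 0
    rw [fabLimitWeight_zero hα]
    rw [neg_zero] at this ⊢
    linarith
  · exact (fabLimitWeight_lt hα h).le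

/-! ### The marginal likelihood as a Laplace transform -/

/-- Integrate `1 + v ≤ exp v` at `v = (u - t)(x - m)` against the `t`-tilted measure. Since `m` is
the tilted mean, the linear term integrates to zero; equality holds only at `x = m`, and `ν` charges
the complement of that point. -/
lemma mgf_id_tangent_lt {ν : Measure ℝ} (hint : ∀ t, Integrable (fun x => Real.exp (t * x)) ν)
    (hν : ∀ x, ν {x}ᶜ ≠ 0) {t u : ℝ} (hut : u ≠ t) (hpos : 0 < mgf id ν t) :
    mgf id ν t * Real.exp ((u - t) * ((∫ x, x * Real.exp (t * x) ∂ν) / mgf id ν t)) <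
      mgf id ν u := by
  have hset : integrableExpSet id ν = univ := eq_univ_of_forall hint
  have hint1 : Integrable (fun x => x * Real.exp (t * x)) ν := by
    simpa using integrable_pow_mul_exp_of_mem_interior_integrableExpSet (X := id) (μ := ν)
      (v := t) (by simp [hset]) 1
  set m := (∫ x, x * Real.exp (t * x) ∂ν) / mgf id ν t with hm
  set E := Real.exp ((u - t) * m)
  have hI : ∫ x, x * Real.exp (t * x) ∂ν = m * mgf id ν t := by
    rw [hm, div_mul_cancel₀ _ hpos.ne']
  let D : ℝ → ℝ := fun x => Real.exp (u * x) -
    (E * (1 - (u - t) * m) * Real.exp (t * x) + E * (u - t) * (x * Real.exp (t * x)))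
  have hD : ∀ x, D x = Real.exp (t * x) * E *
      (Real.exp ((u - t) * (x - m)) - ((u - t) * (x - m) + 1)) := by
    intro x
    have : Real.exp (u * x) = Real.exp (t * x) * E * Real.exp ((u - t) * (x - m)) := by
      simp only [E, ← Real.exp_add]
      congr 1
      ring
    simp only [D, this]
    ring
  have hDint : Integrable D ν :=
    (hint u).sub (((hint t).const_mul _).add (hint1.const_mul _))
  have hDpos : ∀ x, x ≠ m → 0 < D x := fun x hx => by
    rw [hD]
    exact mul_pos (mul_pos (Real.exp_pos _) (Real.exp_pos _)) (sub_pos.2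
      (Real.add_one_lt_exp (mul_ne_zero (sub_ne_zero.2 hut) (sub_ne_zero.2 hx))))
  have hD0 : 0 ≤ D := fun x => by
    rw [Pi.zero_apply, hD]
    exact mul_nonneg (mul_nonneg (Real.exp_pos _).le (Real.exp_pos _).le)
      (sub_nonneg.2 (Real.add_one_le_exp _))
  have hlt : 0 < ∫ x, D x ∂ν := by
    rw [integral_pos_iff_support_of_nonneg hD0 hDint]
    exact (pos_iff_ne_zero.2 (hν m)).trans_le (measure_mono fun x hx => (hDpos x hx).ne')
  have hDval : ∫ x, D x ∂ν = mgf id ν u - mgf id ν t * E := by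
    simp only [D]
    have hA := (hint t).const_mul (E * (1 - (u - t) * m))
    have hB := hint1.const_mul (E * (u - t))
    have hAB : Integrable (fun x => E * (1 - (u - t) * m) * Real.exp (t * x) +
      E * (u - t) * (x * Real.exp (t * x))) ν := hA.add hB
    rw [integral_sub (hint u) hAB, integral_add hA hB, integral_const_mul,
      integral_const_mul, hI]
    simp only [mgf, id]
    ring
  linarith

/-- Expanding the square separates `y` from `θ` up to the factor `exp(yθ/σ²)`, so one tilted measure
serves all observations. -/
lemma fabLikelihood_eq {σ : ℝ} (hσ : 0 < σ) (θ y : ℝ) :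
    fabLikelihood σ θ y =
      Real.exp (-(y ^ 2 / (2 * σ ^ 2))) * (fabLikelihood σ θ 0 * Real.exp (y / σ ^ 2 * θ)) := by
  have hv : ((fabVar σ : ℝ≥0) : ℝ) = σ ^ 2 := rfl
  unfold fabLikelihood gaussianPDFReal
  rw [hv, mul_left_comm, mul_assoc, mul_left_comm, ← Real.exp_add, mul_assoc, ← Real.exp_add]
  congr 2
  field_simp
  ring

lemma fabLikelihood_pos {σ : ℝ} (hσ : 0 < σ) (θ y : ℝ) : 0 < fabLikelihood σ θ y :=
  gaussianPDFReal_pos _ _ _ (fabVar_ne_zero hσ)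

lemma continuous_fabLikelihood_left (σ y : ℝ) : Continuous fun θ => fabLikelihood σ θ y := by
  unfold fabLikelihood gaussianPDFReal
  fun_prop

lemma log_fabLikelihood {σ : ℝ} (hσ : 0 < σ) (θ y : ℝ) :
    Real.log (fabLikelihood σ θ y) =
      -((y - θ) ^ 2 / (2 * σ ^ 2)) - Real.log √(2 * Real.pi * σ ^ 2) := by
  have hv : ((fabVar σ : ℝ≥0) : ℝ) = σ ^ 2 := rfl
  unfold fabLikelihood gaussianPDFReal
  rw [hv, Real.log_mul (by positivity) (by positivity), Real.log_inv, Real.log_exp]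
  ring

/-- The prior reweighted by the likelihood at the observation `0`. -/
def fabTilt (σ : ℝ) (prior : Measure ℝ) : Measure ℝ :=
  prior.withDensity fun θ => ENNReal.ofReal (fabLikelihood σ θ 0)

/-! ### The tilted prior, Tweedie's formula and the tangent parabola -/

section Tilt

variable {σ : ℝ} {prior : Measure ℝ}

lemma integral_fabTilt (hσ : 0 < σ) (g : ℝ → ℝ) :
    ∫ θ, g θ ∂fabTilt σ prior = ∫ θ, fabLikelihood σ θ 0 * g θ ∂prior := by
  rw [fabTilt, integral_withDensity_eq_integral_toReal_smul
    (continuous_fabLikelihood_left σ 0).measurable.ennreal_ofReal (by simp)]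
  simp only [ENNReal.toReal_ofReal (fabLikelihood_pos hσ _ _).le, smul_eq_mul]

lemma integrable_fabTilt_iff (hσ : 0 < σ) (g : ℝ → ℝ) :
    Integrable g (fabTilt σ prior) ↔ Integrable (fun θ => fabLikelihood σ θ 0 * g θ) prior := by
  rw [fabTilt, integrable_withDensity_iff_integrable_smul'
    (continuous_fabLikelihood_left σ 0).measurable.ennreal_ofReal (by simp)]
  simp only [ENNReal.toReal_ofReal (fabLikelihood_pos hσ _ _).le, smul_eq_mul]

lemma integrable_fabLikelihood (hσ : 0 < σ) (hprior : FabAdmissiblePrior σ prior) (y : ℝ) :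
    Integrable (fun θ => fabLikelihood σ θ y) prior := by
  refine ⟨(continuous_fabLikelihood_left σ y).aestronglyMeasurable, ?_⟩
  rw [hasFiniteIntegral_iff_ofReal (ae_of_all _ fun θ => (fabLikelihood_pos hσ θ y).le)]
  exact hprior.marginal_lt_top y

lemma integrable_exp_mul_fabTilt (hσ : 0 < σ) (hprior : FabAdmissiblePrior σ prior) (t : ℝ) :
    Integrable (fun θ => Real.exp (t * θ)) (fabTilt σ prior) := by
  rw [integrable_fabTilt_iff hσ]
  -- The exponential moment of order `t` is the marginal likelihood of the observation `t σ²`, up to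
  -- a constant factor.
  have h := (integrable_fabLikelihood hσ hprior (t * σ ^ 2)).const_mul
    (Real.exp ((t * σ ^ 2) ^ 2 / (2 * σ ^ 2)))
  refine h.congr (ae_of_all _ fun θ => ?_)
  simp only
  rw [fabLikelihood_eq hσ θ (t * σ ^ 2), ← mul_assoc, ← Real.exp_add, add_neg_cancel,
    Real.exp_zero, one_mul, mul_div_cancel_right₀ _ (by positivity)]

lemma fabTilt_compl_singleton_ne_zero (hσ : 0 < σ) (hprior : FabAdmissiblePrior σ prior)
    (x : ℝ) : fabTilt σ prior {x}ᶜ ≠ 0 := by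
  rw [fabTilt, Ne, withDensity_apply_eq_zero
    (continuous_fabLikelihood_left σ 0).measurable.ennreal_ofReal]
  have : {θ | ENNReal.ofReal (fabLikelihood σ θ 0) ≠ 0} = univ :=
    eq_univ_of_forall fun θ => by simpa using fabLikelihood_pos hσ θ 0
  rw [this, univ_inter]
  exact hprior.nondegenerate x

lemma fabMarginal_eq (hσ : 0 < σ) (y : ℝ) :
    fabMarginal σ prior y =
      Real.exp (-(y ^ 2 / (2 * σ ^ 2))) * mgf id (fabTilt σ prior) (y / σ ^ 2) := by
  rw [mgf, integral_fabTilt hσ, ← integral_const_mul, fabMarginal]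
  exact integral_congr_ae (ae_of_all _ fun θ => fabLikelihood_eq hσ θ y)

lemma fabMarginal_pos (hσ : 0 < σ) (hprior : FabAdmissiblePrior σ prior) (y : ℝ) :
    0 < fabMarginal σ prior y := by
  have h := hprior.marginal_pos y
  rw [← ofReal_integral_eq_lintegral_ofReal (integrable_fabLikelihood hσ hprior y)
    (ae_of_all _ fun θ => (fabLikelihood_pos hσ θ y).le)] at h
  exact ENNReal.ofReal_pos.1 h

lemma mgf_fabTilt_pos (hσ : 0 < σ) (hprior : FabAdmissiblePrior σ prior) (y : ℝ) :
    0 < mgf id (fabTilt σ prior) (y / σ ^ 2) :=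
  pos_of_mul_pos_right (fabMarginal_eq (prior := prior) hσ y ▸ fabMarginal_pos hσ hprior y)
    (Real.exp_pos _).le

lemma fabPosteriorMean_eq (hσ : 0 < σ) (y : ℝ) :
    fabPosteriorMean σ prior y =
      (∫ θ, θ * Real.exp (y / σ ^ 2 * θ) ∂fabTilt σ prior) /
        mgf id (fabTilt σ prior) (y / σ ^ 2) := by
  rw [fabPosteriorMean, fabMarginal_eq hσ, integral_fabTilt hσ,
    ← mul_div_mul_left (∫ θ, fabLikelihood σ θ 0 * (θ * Real.exp (y / σ ^ 2 * θ)) ∂prior) _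
      (Real.exp_pos (-(y ^ 2 / (2 * σ ^ 2)))).ne', ← integral_const_mul]
  congr 1
  refine integral_congr_ae (ae_of_all _ fun θ => ?_)
  simp only
  rw [fabLikelihood_eq hσ θ y]
  ring

lemma log_fabMarginal (hσ : 0 < σ) (hprior : FabAdmissiblePrior σ prior) (y : ℝ) :
    Real.log (fabMarginal σ prior y) =
      -(y ^ 2 / (2 * σ ^ 2)) + Real.log (mgf id (fabTilt σ prior) (y / σ ^ 2)) := by
  rw [fabMarginal_eq hσ, Real.log_mul (Real.exp_pos _).ne' (mgf_fabTilt_pos hσ hprior y).ne',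
    Real.log_exp]

/-- Tweedie's formula: the log-Laplace transform contributes the posterior mean, the Gaussian
prefactor contributes `-y`. -/
lemma hasDerivAt_log_fabMarginal (hσ : 0 < σ) (hprior : FabAdmissiblePrior σ prior) (y : ℝ) :
    HasDerivAt (fun y => Real.log (fabMarginal σ prior y))
      ((fabPosteriorMean σ prior y - y) / σ ^ 2) y := by
  have hset : integrableExpSet id (fabTilt σ prior) = univ :=
    eq_univ_of_forall (integrable_exp_mul_fabTilt hσ hprior)
  have h1 : HasDerivAt (mgf id (fabTilt σ prior)) _ (y / σ ^ 2) :=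
    hasDerivAt_mgf (by simp [hset])
  have hdiv : HasDerivAt (fun z : ℝ => z / σ ^ 2) (1 / σ ^ 2) y :=
    (hasDerivAt_id y).div_const (σ ^ 2)
  have h2 : HasDerivAt (fun z => mgf id (fabTilt σ prior) (z / σ ^ 2)) _ y :=
    HasDerivAt.comp (h := fun z => z / σ ^ 2) y h1 hdiv
  have h3 : HasDerivAt (fun z : ℝ => -(z ^ 2 / (2 * σ ^ 2))) (-(2 * y / (2 * σ ^ 2))) y :=
    ((hasDerivAt_pow 2 y).div_const (2 * σ ^ 2)).neg.congr_deriv (by norm_num)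
  have h4 := (h3.add (h2.log (mgf_fabTilt_pos hσ hprior y).ne')).congr_of_eventuallyEq
    (f₁ := fun y => Real.log (fabMarginal σ prior y))
    (Eventually.of_forall fun z => log_fabMarginal hσ hprior z)
  refine h4.congr_deriv ?_
  rw [fabPosteriorMean_eq hσ]
  simp only [id]
  field_simp
  ring

lemma log_fabMarginal_tangent_lt (hσ : 0 < σ) (hprior : FabAdmissiblePrior σ prior)
    {y z : ℝ} (hzy : z ≠ y) :
    Real.log (fabMarginal σ prior y) + (fabPosteriorMean σ prior y - y) / σ ^ 2 * (z - y)
      - (z - y) ^ 2 / (2 * σ ^ 2) < Real.log (fabMarginal σ prior z) := by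
  have hne : z / σ ^ 2 ≠ y / σ ^ 2 := fun h => hzy ((div_left_inj' (by positivity)).1 h)
  have hpos := mgf_fabTilt_pos hσ hprior y
  have h := mgf_id_tangent_lt (integrable_exp_mul_fabTilt hσ hprior)
    (fabTilt_compl_singleton_ne_zero hσ hprior) hne hpos
  rw [← fabPosteriorMean_eq hσ] at h
  have h' := Real.log_lt_log (mul_pos hpos (Real.exp_pos _)) h
  rw [Real.log_mul hpos.ne' (Real.exp_pos _).ne', Real.log_exp] at h'
  rw [log_fabMarginal hσ hprior, log_fabMarginal hσ hprior]
  set m := fabPosteriorMean σ prior y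
  have e : -(y ^ 2 / (2 * σ ^ 2)) + (m - y) / σ ^ 2 * (z - y) - (z - y) ^ 2 / (2 * σ ^ 2) =
      -(z ^ 2 / (2 * σ ^ 2)) + (z / σ ^ 2 - y / σ ^ 2) * m := by
    field_simp
    ring
  linarith

end Tilt

/-! ### Growth of the marginal likelihood -/

/-- In the increment the constant `γ` cancels and the power has ratio tending to `1`, so only the
exponential rate survives. The number `ε` is the sign of `y` along `F`, which lets one statement
cover both tails. -/
lemma tendsto_log_sub_log_of_isEquivalent {F : Filter ℝ} {f : ℝ → ℝ} {γ δ ρ h ε : ℝ}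
    (hγ : 0 < γ) (hf : Asymptotics.IsEquivalent F f
      (fun y => γ * |y| ^ (-δ) * Real.exp (-ρ * |y|)))
    (hpos : ∀ y, 0 < f y)
    (habs : Tendsto (fun y : ℝ => |y|) F atTop) (hshift : Tendsto (fun y : ℝ => y + h) F F)
    (hε : ∀ᶠ y in F, |y + h| - |y| = ε * h) :
    Tendsto (fun y => Real.log (f (y + h)) - Real.log (f y)) F (𝓝 (-ρ * (ε * h))) := by
  set g : ℝ → ℝ := fun y => γ * |y| ^ (-δ) * Real.exp (-ρ * |y|) with hg
  have hgpos : ∀ᶠ y in F, 0 < g y := by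
    filter_upwards [habs.eventually_gt_atTop 0] with y hy
    positivity
  have hlog : Tendsto (fun y => Real.log (f y) - Real.log (g y)) F (𝓝 0) := by
    have h1 : Tendsto (f / g) F (𝓝 1) :=
      (Asymptotics.isEquivalent_iff_tendsto_one (hgpos.mono fun y hy => hy.ne')).1 hf
    have h2 := h1.log one_ne_zero
    rw [Real.log_one] at h2
    refine h2.congr' ?_
    filter_upwards [hgpos] with y hy
    rw [Pi.div_apply, Real.log_div (hpos y).ne' hy.ne']
  have hratio : Tendsto (fun y => Real.log |y + h| - Real.log |y|) F (𝓝 0) := by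
    have h1 : Tendsto (fun y : ℝ => 1 + ε * h * |y|⁻¹) F (𝓝 (1 + ε * h * 0)) :=
      ((tendsto_inv_atTop_zero.comp habs).const_mul _).const_add _
    rw [mul_zero, add_zero] at h1
    have h2 := h1.log one_ne_zero
    rw [Real.log_one] at h2
    refine h2.congr' ?_
    filter_upwards [hε, habs.eventually_gt_atTop 0,
      (habs.comp hshift).eventually_gt_atTop 0] with y h3 h4 h5
    simp only [Function.comp] at h5
    rw [← Real.log_div (ne_of_gt h5) h4.ne', ← h3]
    congr 1
    field_simp
    ring
  have hgg : Tendsto (fun y => Real.log (g (y + h)) - Real.log (g y)) F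
      (𝓝 (-ρ * (ε * h))) := by
    have h1 := (hratio.const_mul (-δ)).add_const (-ρ * (ε * h))
    rw [mul_zero, zero_add] at h1
    refine h1.congr' ?_
    filter_upwards [hε, habs.eventually_gt_atTop 0,
      (habs.comp hshift).eventually_gt_atTop 0] with y h3 h4 h5
    simp only [Function.comp] at h5
    have hl : ∀ z : ℝ, 0 < |z| → Real.log (g z) = Real.log γ + -δ * Real.log |z| + -ρ * |z| := by
      intro z hz
      have := Real.rpow_pos_of_pos hz (-δ)
      rw [hg]
      simp only
      rw [Real.log_mul (by positivity) (by positivity), Real.log_mul hγ.ne' this.ne',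
        Real.log_exp, Real.log_rpow hz]
    rw [hl _ h4, hl _ h5, ← h3]
    ring
  have h := ((hlog.comp hshift).add hgg).sub hlog
  rw [zero_add, sub_zero] at h
  exact h.congr fun y => by simp only [Function.comp]; ring

/-! ### Strictly convex functions on the line -/

lemma StrictConvexOn.setOf_le_eq_Icc {h : ℝ → ℝ} (hh : StrictConvexOn ℝ univ h) {a b : ℝ}
    (hab : a < b) (heq : h a = h b) : {x | h x ≤ h a} = Icc a b := by
  ext x
  simp only [mem_ofPred_eq]
  constructor
  · intro hx
    by_contra hn
    rw [mem_Icc, not_and_or, not_le, not_le] at hn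
    rcases hn with hn | hn
    · have := hh.slope_strict_mono_adjacent (mem_univ x) (mem_univ b) hn hab
      rw [← heq, sub_self, zero_div] at this
      exact absurd this (not_lt.2 (div_nonneg (sub_nonneg.2 hx) (sub_pos.2 hn).le))
    · have := hh.slope_strict_mono_adjacent (mem_univ a) (mem_univ x) hab hn
      rw [← heq, sub_self, zero_div] at this
      exact absurd this (not_lt.2 (div_nonpos_of_nonpos_of_nonneg (sub_nonpos.2 hx)
        (sub_pos.2 hn).le))
  · intro hx
    rw [← segment_eq_Icc hab.le] at hx
    have := hh.convexOn.le_max_of_mem_segment (mem_univ a) (mem_univ b) hx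
    rwa [← heq, max_self] at this

/-- Chord slopes increase strictly with either end, so moving both ends of a flat chord to the right
tilts it upwards. This makes the imbalance change sign at the balanced weight. -/
lemma StrictConvexOn.lt_of_translate_right {h : ℝ → ℝ} (hh : StrictConvexOn ℝ univ h)
    {a b a' b' : ℝ} (hab : a < b) (heq : h a = h b) (ha : a < a') (hb : b < b')
    (hab' : a' < b') : h a' < h b' := by
  have h1 := hh.secant_strict_mono (mem_univ a) (mem_univ b) (mem_univ b') hab.ne'
    (hab.trans hb).ne' hb
  rw [heq, sub_self, zero_div, ← heq, lt_div_iff₀ (sub_pos.2 (hab.trans hb)), zero_mul,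
    sub_pos] at h1
  have h2 := hh.secant_strict_mono (mem_univ b') (mem_univ a) (mem_univ a') (hab.trans hb).ne
    hab'.ne ha
  have h3 := (div_pos_of_neg_of_neg (sub_neg.2 h1) (sub_neg.2 (hab.trans hb))).trans h2
  rcases div_pos_iff.1 h3 with h4 | h4
  · exact absurd h4.2 (not_lt.2 (sub_nonpos.2 hab'.le))
  · exact sub_neg.1 h4.1

lemma StrictConvexOn.lt_of_translate_left {h : ℝ → ℝ} (hh : StrictConvexOn ℝ univ h)
    {a b a' b' : ℝ} (hab : a < b) (heq : h a = h b) (ha : a' < a) (hb : b' < b)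
    (hab' : a' < b') : h b' < h a' := by
  have h1 := hh.secant_strict_mono (mem_univ b) (mem_univ a') (mem_univ a) (ha.trans hab).ne
    hab.ne ha
  rw [heq, sub_self, zero_div, div_lt_iff_of_neg (sub_neg.2 (ha.trans hab)), zero_mul,
    sub_pos] at h1
  have h2 := hh.secant_strict_mono (mem_univ a') (mem_univ b') (mem_univ b) hab'.ne'
    (ha.trans hab).ne' hb
  have h3 := h2.trans (div_neg_of_neg_of_pos (sub_neg.2 h1) (sub_pos.2 (ha.trans hab)))
  rcases div_neg_iff.1 h3 with h4 | h4
  · exact absurd h4.2 (not_lt.2 (sub_nonneg.2 hab'.le))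
  · exact sub_neg.1 h4.1

lemma Continuous.exists_forall_abs_le_of_tendsto {u : ℝ → ℝ} (hu : Continuous u) {a b : ℝ}
    (htop : Tendsto u atTop (𝓝 a)) (hbot : Tendsto u atBot (𝓝 b)) : ∃ B, ∀ x, |u x| ≤ B := by
  obtain ⟨M, hM⟩ := eventually_atTop.1 (htop.abs.eventually_le_const (lt_add_one |a|))
  obtain ⟨N, hN⟩ := eventually_atBot.1 (hbot.abs.eventually_le_const (lt_add_one |b|))
  obtain ⟨C, hC⟩ := (isCompact_Icc (a := N) (b := M)).exists_bound_of_continuousOn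
    hu.continuousOn
  refine ⟨max C (max (|a| + 1) (|b| + 1)), fun x => ?_⟩
  rcases le_total M x with h | h
  · exact (hM x h).trans ((le_max_left _ _).trans (le_max_right _ _))
  · rcases le_total x N with h' | h'
    · exact (hN x h').trans ((le_max_right _ _).trans (le_max_right _ _))
    · exact (hC x ⟨h', h⟩).trans (le_max_left _ _)

/-! ### Log-densities with a strict Gaussian tangent bound and exponential tails -/

/-- The properties of the log-marginal `L` and the posterior mean `m` used below: Tweedie's formula,
a strict lower bound by the tangent parabola at each point, and exponential tails of rate `κ / σ`. -/
structure IsTiltedLogDensity (σ κ : ℝ) (L m : ℝ → ℝ) : Prop where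
  hasDerivAt : ∀ y, HasDerivAt L ((m y - y) / σ ^ 2) y
  tangent_lt : ∀ y z, z ≠ y →
    L y + (m y - y) / σ ^ 2 * (z - y) - (z - y) ^ 2 / (2 * σ ^ 2) < L z
  tendsto_top : ∀ h, Tendsto (fun y => L (y + h) - L y) atTop (𝓝 (-(κ / σ) * h))
  tendsto_bot : ∀ h, Tendsto (fun y => L (y + h) - L y) atBot (𝓝 (κ / σ * h))

/-- The log-likelihood ratio up to an additive constant. -/
def penalizedLog (σ : ℝ) (L : ℝ → ℝ) (θ y : ℝ) : ℝ := L y + (y - θ) ^ 2 / (2 * σ ^ 2)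

/-! ### Balanced weights -/

/-- `ω` is the share of the error probability `α` spent in the left tail by the interval of
acceptance probability `1 - α` whose end points have equal log-likelihood ratio. -/
structure IsBalancedWeight (σ : ℝ) (L : ℝ → ℝ) (α θ ω : ℝ) : Prop where
  mem : ω ∈ Ioo (0 : ℝ) 1
  eq : penalizedLog σ L θ (θ + σ * stdNormalQuantile (α * ω)) =
    penalizedLog σ L θ (θ + σ * -stdNormalQuantile (α * (1 - ω)))

lemma stdNormalQuantile_mul_lt_neg {α ω : ℝ} (hα : α ∈ Ioo (0 : ℝ) 1)
    (hω : ω ∈ Ioo (0 : ℝ) 1) : stdNormalQuantile (α * ω) < -stdNormalQuantile (α * (1 - ω)) := by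
  have h := mul_mem_Ioo_zero_one hα (one_sub_mem_Ioo hω)
  rw [← stdNormalQuantile_one_sub h]
  refine strictMonoOn_stdNormalQuantile (mul_mem_Ioo_zero_one hα hω) (one_sub_mem_Ioo h) ?_
  linarith [hα.2]

/-! ### Consequences of the tangent bound and the tails -/

namespace IsTiltedLogDensity

variable {σ κ : ℝ} {L m : ℝ → ℝ}

lemma continuous (H : IsTiltedLogDensity σ κ L m) : Continuous L :=
  continuous_iff_continuousAt.2 fun y => (H.hasDerivAt y).continuousAt

/-- The tangent parabola bounds `m y - y` by difference quotients of `L` from both sides, with error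
`h/2` for step `h`. Limits of increments thus pass to the derivative. -/
lemma tendsto_mean_sub (H : IsTiltedLogDensity σ κ L m) (hσ : 0 < σ) {F : Filter ℝ} {ρ : ℝ}
    (hF : ∀ h, Tendsto (fun y => L (y + h) - L y) F (𝓝 (ρ * h))) :
    Tendsto (fun y => m y - y) F (𝓝 (σ ^ 2 * ρ)) := by
  have hσ2 : 0 < σ ^ 2 := by positivity
  have key : ∀ y h, h ≠ 0 → (m y - y) * h < σ ^ 2 * (L (y + h) - L y) + h ^ 2 / 2 := by
    intro y h hh
    have h1 := H.tangent_lt y (y + h) (by simpa using hh)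
    rw [add_sub_cancel_left] at h1
    have h2 := mul_lt_mul_of_pos_left h1 hσ2
    have h3 : σ ^ 2 * (L y + (m y - y) / σ ^ 2 * h - h ^ 2 / (2 * σ ^ 2)) =
        σ ^ 2 * L y + (m y - y) * h - h ^ 2 / 2 := by
      field_simp
    linarith
  have hlim : ∀ h, Tendsto (fun y => σ ^ 2 * (L (y + h) - L y) + h ^ 2 / 2) F
      (𝓝 (σ ^ 2 * (ρ * h) + h ^ 2 / 2)) := fun h => ((hF h).const_mul _).add_const _
  refine tendsto_order.2 ⟨fun a ha => ?_, fun a ha => ?_⟩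
  -- The step equals the gap to be beaten, so the error `h/2` uses up only half of it.
  · set h := σ ^ 2 * ρ - a
    have hh : 0 < h := sub_pos.2 ha
    filter_upwards [(hlim (-h)).eventually_lt_const
      (show σ ^ 2 * (ρ * -h) + (-h) ^ 2 / 2 < -a * h by
        have : -a * h = h ^ 2 - σ ^ 2 * ρ * h := by simp only [h]; ring
        nlinarith)] with y hy
    have := key y (-h) (neg_ne_zero.2 hh.ne')
    nlinarith
  · set h := a - σ ^ 2 * ρ
    have hh : 0 < h := sub_pos.2 ha
    filter_upwards [(hlim h).eventually_lt_const
      (show σ ^ 2 * (ρ * h) + h ^ 2 / 2 < a * h by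
        have : a * h = h ^ 2 + σ ^ 2 * ρ * h := by simp only [h]; ring
        nlinarith)] with y hy
    have := key y h hh.ne'
    nlinarith

lemma tendsto_sub_mean_atTop (H : IsTiltedLogDensity σ κ L m) (hσ : 0 < σ) :
    Tendsto (fun y => y - m y) atTop (𝓝 (σ * κ)) := by
  have h := (H.tendsto_mean_sub hσ H.tendsto_top).neg
  rw [show -(σ ^ 2 * -(κ / σ)) = σ * κ by field_simp] at h
  exact h.congr fun y => neg_sub _ _

lemma tendsto_mean_sub_atBot (H : IsTiltedLogDensity σ κ L m) (hσ : 0 < σ) :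
    Tendsto (fun y => m y - y) atBot (𝓝 (σ * κ)) := by
  have h := H.tendsto_mean_sub hσ H.tendsto_bot
  rwa [show σ ^ 2 * (κ / σ) = σ * κ by field_simp] at h

lemma penalizedLog_tangent_lt (H : IsTiltedLogDensity σ κ L m) (hσ : 0 < σ) (θ : ℝ) {y z : ℝ}
    (hzy : z ≠ y) :
    penalizedLog σ L θ y + (m y - θ) / σ ^ 2 * (z - y) < penalizedLog σ L θ z := by
  have h := H.tangent_lt y z hzy
  unfold penalizedLog
  have : (y - θ) ^ 2 / (2 * σ ^ 2) + (m y - θ) / σ ^ 2 * (z - y) - (z - θ) ^ 2 / (2 * σ ^ 2) =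
      (m y - y) / σ ^ 2 * (z - y) - (z - y) ^ 2 / (2 * σ ^ 2) := by
    field_simp
    ring
  linarith

lemma continuous_penalizedLog (H : IsTiltedLogDensity σ κ L m) (θ : ℝ) :
    Continuous (penalizedLog σ L θ) :=
  H.continuous.add (by fun_prop)

lemma strictConvexOn_penalizedLog (H : IsTiltedLogDensity σ κ L m) (hσ : 0 < σ) (θ : ℝ) :
    StrictConvexOn ℝ univ (penalizedLog σ L θ) := by
  refine ⟨convex_univ, fun x _ y _ hxy a b ha hb hab => ?_⟩
  simp only [smul_eq_mul]
  set w := a * x + b * y with hw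
  have hx : x - w = b * (x - y) := by
    rw [hw, ← sub_eq_iff_eq_add'.2 hab.symm]; ring
  have hy : y - w = -(a * (x - y)) := by
    rw [hw, ← sub_eq_iff_eq_add.2 hab.symm]; ring
  have hxy' := sub_ne_zero.2 hxy
  have h1 := H.penalizedLog_tangent_lt hσ θ (y := w) (z := x)
    (sub_ne_zero.1 (hx ▸ mul_ne_zero hb.ne' hxy'))
  have h2 := H.penalizedLog_tangent_lt hσ θ (y := w) (z := y)
    (sub_ne_zero.1 (hy ▸ neg_ne_zero.2 (mul_ne_zero ha.ne' hxy')))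
  rw [hx] at h1
  rw [hy] at h2
  have h3 := add_lt_add (mul_lt_mul_of_pos_left h1 ha) (mul_lt_mul_of_pos_left h2 hb)
  have h4 : a * (penalizedLog σ L θ w + (m w - θ) / σ ^ 2 * (b * (x - y))) +
      b * (penalizedLog σ L θ w + (m w - θ) / σ ^ 2 * -(a * (x - y))) =
      (a + b) * penalizedLog σ L θ w := by ring
  rwa [h4, hab, one_mul] at h3

/-- As `m` is unbounded above, some tangent line has positive slope, and the function lies above it.
-/
lemma tendsto_penalizedLog_atTop (H : IsTiltedLogDensity σ κ L m) (hσ : 0 < σ) (θ : ℝ) :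
    Tendsto (penalizedLog σ L θ) atTop atTop := by
  have hm : Tendsto m atTop atTop :=
    ((H.tendsto_mean_sub hσ H.tendsto_top).add_atTop tendsto_id).congr fun y => by simp
  obtain ⟨y, hy⟩ := (hm.eventually_gt_atTop θ).exists
  have hs : 0 < (m y - θ) / σ ^ 2 := div_pos (sub_pos.2 hy) (by positivity)
  refine tendsto_atTop_mono' atTop ?_ (tendsto_atTop_add_const_left _ (penalizedLog σ L θ y)
    ((tendsto_atTop_add_const_right _ (-y) tendsto_id).const_mul_atTop hs))
  filter_upwards [eventually_gt_atTop y] with z hz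
  exact (H.penalizedLog_tangent_lt hσ θ hz.ne').le

lemma tendsto_penalizedLog_atBot (H : IsTiltedLogDensity σ κ L m) (hσ : 0 < σ) (θ : ℝ) :
    Tendsto (penalizedLog σ L θ) atBot atTop := by
  have hm : Tendsto m atBot atBot :=
    ((H.tendsto_mean_sub hσ H.tendsto_bot).add_atBot tendsto_id).congr fun y => by simp
  obtain ⟨y, hy⟩ := (hm.eventually_lt_atBot θ).exists
  have hs : (m y - θ) / σ ^ 2 < 0 := div_neg_of_neg_of_pos (sub_neg.2 hy) (by positivity)
  refine tendsto_atTop_mono' atBot ?_ (tendsto_atTop_add_const_left _ (penalizedLog σ L θ y)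
    ((tendsto_atBot_add_const_right _ (-y) tendsto_id).const_mul_atBot_of_neg hs))
  filter_upwards [eventually_lt_atBot y] with z hz
  exact (H.penalizedLog_tangent_lt hσ θ hz.ne).le

/-- The slope at `y` is `(m y - θ)/σ²`; where it vanishes, the tangent bound makes `y` a global
minimum. -/
lemma forall_penalizedLog_le_iff (H : IsTiltedLogDensity σ κ L m) (hσ : 0 < σ) {θ y : ℝ} :
    (∀ z, penalizedLog σ L θ y ≤ penalizedLog σ L θ z) ↔ θ = m y := by
  constructor
  · intro h
    have h1 : HasDerivAt (fun z : ℝ => (z - θ) ^ 2 / (2 * σ ^ 2)) ((y - θ) / σ ^ 2) y := by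
      refine ((((hasDerivAt_id y).sub_const θ).fun_pow 2).div_const (2 * σ ^ 2)).congr_deriv ?_
      simp only [id]
      field_simp
      ring
    have h2 : HasDerivAt (penalizedLog σ L θ) _ y := (H.hasDerivAt y).add h1
    have hmin : IsLocalMin (penalizedLog σ L θ) y := Eventually.of_forall h
    have h3 := hmin.hasDerivAt_eq_zero h2
    rw [← add_div, div_eq_zero_iff, or_iff_left (by positivity)] at h3
    linarith
  · rintro rfl z
    rcases eq_or_ne z y with rfl | hz
    · exact le_rfl
    · simpa using (H.penalizedLog_tangent_lt hσ (m y) hz).le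

/-! ### Existence, continuity and limits of the balanced weight -/

/-- As `ω → 0` the left end escapes to `-∞` while the right end stays bounded, so coercivity makes
the left value larger; as `ω → 1` the roles are exchanged. -/
lemma exists_isBalancedWeight (H : IsTiltedLogDensity σ κ L m) (hσ : 0 < σ) {α : ℝ}
    (hα : α ∈ Ioo (0 : ℝ) 1) (θ : ℝ) : ∃ ω, IsBalancedWeight σ L α θ ω := by
  have hc := H.continuous_penalizedLog θ
  have haff : Continuous fun z : ℝ => θ + σ * z := by fun_prop
  let D : ℝ → ℝ := fun ω => penalizedLog σ L θ (θ + σ * -stdNormalQuantile (α * (1 - ω))) -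
    penalizedLog σ L θ (θ + σ * stdNormalQuantile (α * ω))
  have hD : ContinuousOn D (Ioo 0 1) :=
    ((hc.comp haff).comp_continuousOn (continuousOn_stdNormalQuantile_mul_one_sub hα).neg).sub
      ((hc.comp haff).comp_continuousOn (continuousOn_stdNormalQuantile_mul hα))
  have hunit : ∀ᶠ ω in 𝓝[>] (0 : ℝ), ω ∈ Ioo (0 : ℝ) 1 := Ioo_mem_nhdsGT (zero_lt_one' ℝ)
  have hz := tendsto_stdNormalQuantile_mul_zero hα
  have hz1 := tendsto_stdNormalQuantile_mul_one_sub_zero hα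
  have hneg : ∃ ω ∈ Ioo (0 : ℝ) 1, D ω ≤ 0 := by
    have h1 := (H.tendsto_penalizedLog_atBot hσ θ).comp
      (tendsto_atBot_add_const_left _ θ (hz.const_mul_atBot hσ))
    have h2 := ((hc.comp haff).tendsto _).comp hz1.neg
    obtain ⟨ω, hω, h⟩ := (hunit.and ((h2.neg.add_atTop h1).eventually_ge_atTop 0)).exists
    simp only [Function.comp] at h
    exact ⟨ω, hω, by simp only [D]; linarith⟩
  have hpos : ∃ ω ∈ Ioo (0 : ℝ) 1, 0 ≤ D ω := by
    have h1 := (H.tendsto_penalizedLog_atTop hσ θ).comp (tendsto_atTop_add_const_left _ θ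
      ((tendsto_neg_atBot_atTop.comp hz).const_mul_atTop hσ))
    have h2 := ((hc.comp haff).tendsto _).comp hz1
    obtain ⟨ω, hω, h⟩ := (hunit.and ((h2.neg.add_atTop h1).eventually_ge_atTop 0)).exists
    simp only [Function.comp] at h
    -- Reflecting the weight reuses the limits at `0` for the behaviour near `1`.
    refine ⟨1 - ω, one_sub_mem_Ioo hω, ?_⟩
    simp only [D, sub_sub_cancel]
    linarith
  obtain ⟨a, ha, ha'⟩ := hneg
  obtain ⟨b, hb, hb'⟩ := hpos
  obtain ⟨ω, hω, h0⟩ := isPreconnected_Ioo.intermediate_value ha hb hD ⟨ha', hb'⟩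
  exact ⟨ω, hω, (sub_eq_zero.1 h0).symm⟩

section Weight

variable {α : ℝ} {W : ℝ → ℝ}

lemma penalizedLog_lt_of_weight_lt (H : IsTiltedLogDensity σ κ L m) (hσ : 0 < σ)
    (hα : α ∈ Ioo (0 : ℝ) 1) {θ ω₀ ω : ℝ} (h0 : IsBalancedWeight σ L α θ ω₀)
    (hω : ω ∈ Ioo (0 : ℝ) 1) (h : ω₀ < ω) :
    penalizedLog σ L θ (θ + σ * stdNormalQuantile (α * ω)) <
      penalizedLog σ L θ (θ + σ * -stdNormalQuantile (α * (1 - ω))) := by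
  have haff : StrictMono fun z : ℝ => θ + σ * z := fun x y hxy => by
    simpa using mul_lt_mul_of_pos_left hxy hσ
  have h1 := strictMonoOn_stdNormalQuantile_mul hα h0.mem hω h
  have h2 := strictMonoOn_stdNormalQuantile_mul hα (one_sub_mem_Ioo hω)
    (one_sub_mem_Ioo h0.mem) (sub_lt_sub_left h 1)
  exact (H.strictConvexOn_penalizedLog hσ θ).lt_of_translate_right
    (haff (stdNormalQuantile_mul_lt_neg hα h0.mem)) h0.eq (haff h1) (haff (neg_lt_neg h2))
    (haff (stdNormalQuantile_mul_lt_neg hα hω))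

lemma penalizedLog_lt_of_lt_weight (H : IsTiltedLogDensity σ κ L m) (hσ : 0 < σ)
    (hα : α ∈ Ioo (0 : ℝ) 1) {θ ω₀ ω : ℝ} (h0 : IsBalancedWeight σ L α θ ω₀)
    (hω : ω ∈ Ioo (0 : ℝ) 1) (h : ω < ω₀) :
    penalizedLog σ L θ (θ + σ * -stdNormalQuantile (α * (1 - ω))) <
      penalizedLog σ L θ (θ + σ * stdNormalQuantile (α * ω)) := by
  have haff : StrictMono fun z : ℝ => θ + σ * z := fun x y hxy => by
    simpa using mul_lt_mul_of_pos_left hxy hσ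
  have h1 := strictMonoOn_stdNormalQuantile_mul hα hω h0.mem h
  have h2 := strictMonoOn_stdNormalQuantile_mul hα (one_sub_mem_Ioo h0.mem)
    (one_sub_mem_Ioo hω) (sub_lt_sub_left h 1)
  exact (H.strictConvexOn_penalizedLog hσ θ).lt_of_translate_left
    (haff (stdNormalQuantile_mul_lt_neg hα h0.mem)) h0.eq (haff h1) (haff (neg_lt_neg h2))
    (haff (stdNormalQuantile_mul_lt_neg hα hω))

/-- Testing a single fixed weight locates the balanced one. Fixed weights can thus act as barriers,
and limits of the weight need no uniformity in `ω`. -/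
lemma lt_weight (H : IsTiltedLogDensity σ κ L m) (hσ : 0 < σ) (hα : α ∈ Ioo (0 : ℝ) 1)
    {θ ω₀ ω : ℝ} (h0 : IsBalancedWeight σ L α θ ω₀) (hω : ω ∈ Ioo (0 : ℝ) 1)
    (hlt : penalizedLog σ L θ (θ + σ * -stdNormalQuantile (α * (1 - ω))) <
      penalizedLog σ L θ (θ + σ * stdNormalQuantile (α * ω))) : ω < ω₀ := by
  by_contra! h
  rcases h.eq_or_lt with rfl | h
  · exact hlt.ne h0.eq.symm
  · exact hlt.not_gt (H.penalizedLog_lt_of_weight_lt hσ hα h0 hω h)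

lemma weight_lt (H : IsTiltedLogDensity σ κ L m) (hσ : 0 < σ) (hα : α ∈ Ioo (0 : ℝ) 1)
    {θ ω₀ ω : ℝ} (h0 : IsBalancedWeight σ L α θ ω₀) (hω : ω ∈ Ioo (0 : ℝ) 1)
    (hlt : penalizedLog σ L θ (θ + σ * stdNormalQuantile (α * ω)) <
      penalizedLog σ L θ (θ + σ * -stdNormalQuantile (α * (1 - ω)))) : ω₀ < ω := by
  by_contra! h
  rcases h.eq_or_lt with rfl | h
  · exact hlt.ne h0.eq
  · exact hlt.not_gt (H.penalizedLog_lt_of_lt_weight hσ hα h0 hω h)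

/-- A balanced weight converges as soon as the imbalance of every fixed weight converges to a limit
that changes sign at the limiting weight. -/
lemma tendsto_weight (H : IsTiltedLogDensity σ κ L m) (hσ : 0 < σ) (hα : α ∈ Ioo (0 : ℝ) 1)
    (hW : ∀ θ, IsBalancedWeight σ L α θ (W θ)) {F : Filter ℝ} {ω₀ : ℝ} (h0 : ω₀ ∈ Ioo (0 : ℝ) 1)
    {D : ℝ → ℝ} (hD : ∀ ω ∈ Ioo (0 : ℝ) 1, Tendsto
      (fun θ => penalizedLog σ L θ (θ + σ * -stdNormalQuantile (α * (1 - ω))) -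
        penalizedLog σ L θ (θ + σ * stdNormalQuantile (α * ω))) F (𝓝 (D ω)))
    (hneg : ∀ ω ∈ Ioo (0 : ℝ) 1, ω < ω₀ → D ω < 0)
    (hpos : ∀ ω ∈ Ioo (0 : ℝ) 1, ω₀ < ω → 0 < D ω) : Tendsto W F (𝓝 ω₀) := by
  refine tendsto_order.2 ⟨fun a ha => ?_, fun a ha => ?_⟩
  · obtain ⟨ω, h1, h2⟩ := exists_between (max_lt ha h0.1)
    rw [max_lt_iff] at h1
    have hω : ω ∈ Ioo (0 : ℝ) 1 := ⟨h1.2, h2.trans h0.2⟩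
    filter_upwards [(hD ω hω).eventually_lt_const (hneg ω hω h2)] with θ hθ
    exact h1.1.trans (H.lt_weight hσ hα (hW θ) hω (sub_neg.1 hθ))
  · obtain ⟨ω, h1, h2⟩ := exists_between (lt_min ha h0.2)
    rw [lt_min_iff] at h2
    have hω : ω ∈ Ioo (0 : ℝ) 1 := ⟨h0.1.trans h1, h2.2⟩
    filter_upwards [(hD ω hω).eventually_const_lt (hpos ω hω h1)] with θ hθ
    exact (H.weight_lt hσ hα (hW θ) hω (sub_pos.1 hθ)).trans h2.1

lemma continuous_weight (H : IsTiltedLogDensity σ κ L m) (hσ : 0 < σ) (hα : α ∈ Ioo (0 : ℝ) 1)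
    (hW : ∀ θ, IsBalancedWeight σ L α θ (W θ)) : Continuous W := by
  have hLc := H.continuous
  refine continuous_iff_continuousAt.2 fun θ₀ => ?_
  exact H.tendsto_weight hσ hα hW (hW θ₀).mem
    (fun ω _ => Continuous.tendsto (by unfold penalizedLog; fun_prop) θ₀)
    (fun ω hω hlt => sub_neg.2 (H.penalizedLog_lt_of_lt_weight hσ hα (hW θ₀) hω hlt))
    (fun ω hω hlt => sub_pos.2 (H.penalizedLog_lt_of_weight_lt hσ hα (hW θ₀) hω hlt))

lemma tendsto_weight_of_tail (H : IsTiltedLogDensity σ κ L m) (hσ : 0 < σ)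
    (hα : α ∈ Ioo (0 : ℝ) 1) (hW : ∀ θ, IsBalancedWeight σ L α θ (W θ)) {F : Filter ℝ}
    {ρ ω₀ : ℝ} (hF : ∀ h, Tendsto (fun y => L (y + h) - L y) F (𝓝 (ρ * h)))
    (h0 : ω₀ ∈ Ioo (0 : ℝ) 1) (hg : fabG α ω₀ = -(2 * (ρ * σ))) : Tendsto W F (𝓝 ω₀) := by
  have hsign : ∀ ω ∈ Ioo (0 : ℝ) 1,
      0 < (-stdNormalQuantile (α * (1 - ω)) - stdNormalQuantile (α * ω)) / 2 := fun ω hω =>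
    half_pos (sub_pos.2 (stdNormalQuantile_mul_lt_neg hα hω))
  -- With `a = Φ⁻¹(αω)` and `b = Φ⁻¹(α(1 - ω))`, the limiting imbalance is `ρσ(-b - a) + (b² -
  -- a²)/2`. The positive half-length `(-b - a)/2` factors out and leaves the increasing function
  -- `g_α(ω) + 2ρσ`.
  refine H.tendsto_weight hσ hα hW h0 (D := fun ω =>
    (-stdNormalQuantile (α * (1 - ω)) - stdNormalQuantile (α * ω)) / 2 *
      (fabG α ω + 2 * (ρ * σ))) (fun ω _ => ?_) (fun ω hω hlt => ?_) (fun ω hω hlt => ?_)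
  · set a := stdNormalQuantile (α * ω) with ha
    set b := stdNormalQuantile (α * (1 - ω)) with hb
    have h := (((hF (σ * -b)).sub (hF (σ * a))).add_const ((b ^ 2 - a ^ 2) / 2))
    have e : ρ * (σ * -b) - ρ * (σ * a) + (b ^ 2 - a ^ 2) / 2 =
        (-b - a) / 2 * (fabG α ω + 2 * (ρ * σ)) := by
      rw [fabG, ← ha, ← hb]
      ring
    rw [e] at h
    refine h.congr fun θ => ?_
    unfold penalizedLog
    field_simp
    ring
  · have := strictMonoOn_fabG hα hω h0 hlt
    exact mul_neg_of_pos_of_neg (hsign ω hω) (by linarith)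
  · have := strictMonoOn_fabG hα h0 hω hlt
    exact mul_pos (hsign ω hω) (by linarith)

lemma continuous_lower (H : IsTiltedLogDensity σ κ L m) (hσ : 0 < σ) (hα : α ∈ Ioo (0 : ℝ) 1)
    (hW : ∀ θ, IsBalancedWeight σ L α θ (W θ)) :
    Continuous fun θ => σ * stdNormalQuantile (α * W θ) :=
  ((continuousOn_stdNormalQuantile_mul hα).comp_continuous (H.continuous_weight hσ hα hW)
    fun θ => (hW θ).mem).const_mul σ

lemma continuous_upper (H : IsTiltedLogDensity σ κ L m) (hσ : 0 < σ) (hα : α ∈ Ioo (0 : ℝ) 1)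
    (hW : ∀ θ, IsBalancedWeight σ L α θ (W θ)) :
    Continuous fun θ => σ * -stdNormalQuantile (α * (1 - W θ)) :=
  ((continuousOn_stdNormalQuantile_mul_one_sub hα).comp_continuous
    (H.continuous_weight hσ hα hW) fun θ => (hW θ).mem).neg.const_mul σ

lemma tendsto_lower (hα : α ∈ Ioo (0 : ℝ) 1) {F : Filter ℝ} {ω₀ : ℝ}
    (h0 : ω₀ ∈ Ioo (0 : ℝ) 1) (hF : Tendsto W F (𝓝 ω₀)) :
    Tendsto (fun θ => σ * stdNormalQuantile (α * W θ)) F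
      (𝓝 (σ * stdNormalQuantile (α * ω₀))) :=
  (((continuousOn_stdNormalQuantile_mul hα).continuousAt
    (Ioo_mem_nhds h0.1 h0.2)).tendsto.comp hF).const_mul σ

lemma tendsto_upper (hα : α ∈ Ioo (0 : ℝ) 1) {F : Filter ℝ} {ω₀ : ℝ}
    (h0 : ω₀ ∈ Ioo (0 : ℝ) 1) (hF : Tendsto W F (𝓝 ω₀)) :
    Tendsto (fun θ => σ * -stdNormalQuantile (α * (1 - W θ))) F
      (𝓝 (σ * -stdNormalQuantile (α * (1 - ω₀)))) :=
  (((continuousOn_stdNormalQuantile_mul_one_sub hα).continuousAt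
    (Ioo_mem_nhds h0.1 h0.2)).tendsto.comp hF).neg.const_mul σ

lemma tendsto_weight_atTop (H : IsTiltedLogDensity σ κ L m) (hσ : 0 < σ)
    (hα : α ∈ Ioo (0 : ℝ) 1) (hW : ∀ θ, IsBalancedWeight σ L α θ (W θ)) :
    Tendsto W atTop (𝓝 (1 - fabLimitWeight α κ)) := by
  refine H.tendsto_weight_of_tail hσ hα hW H.tendsto_top
    (one_sub_mem_Ioo (fabLimitWeight_mem hα κ)) ?_
  rw [fabG_one_sub, fabG_fabLimitWeight hα]
  field_simp

lemma tendsto_weight_atBot (H : IsTiltedLogDensity σ κ L m) (hσ : 0 < σ)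
    (hα : α ∈ Ioo (0 : ℝ) 1) (hW : ∀ θ, IsBalancedWeight σ L α θ (W θ)) :
    Tendsto W atBot (𝓝 (fabLimitWeight α κ)) := by
  refine H.tendsto_weight_of_tail hσ hα hW H.tendsto_bot (fabLimitWeight_mem hα κ) ?_
  rw [fabG_fabLimitWeight hα]
  field_simp

lemma exists_endpoint_bound (H : IsTiltedLogDensity σ κ L m) (hσ : 0 < σ)
    (hα : α ∈ Ioo (0 : ℝ) 1) (hW : ∀ θ, IsBalancedWeight σ L α θ (W θ)) :
    ∃ B, ∀ θ, -B ≤ σ * stdNormalQuantile (α * W θ) ∧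
      σ * -stdNormalQuantile (α * (1 - W θ)) ≤ B := by
  have hc := fabLimitWeight_mem hα κ
  have hc' := one_sub_mem_Ioo hc
  have htop := H.tendsto_weight_atTop hσ hα hW
  have hbot := H.tendsto_weight_atBot hσ hα hW
  obtain ⟨A, hA⟩ := (H.continuous_lower hσ hα hW).exists_forall_abs_le_of_tendsto
    (tendsto_lower hα hc' htop) (tendsto_lower hα hc hbot)
  obtain ⟨B, hB⟩ := (H.continuous_upper hσ hα hW).exists_forall_abs_le_of_tendsto
    (tendsto_upper hα hc' htop) (tendsto_upper hα hc hbot)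
  refine ⟨max A B, fun θ => ⟨?_, ?_⟩⟩
  · have := (abs_le.1 (hA θ)).1
    linarith [le_max_left A B]
  · exact (abs_le.1 (hB θ)).2.trans (le_max_right A B)

end Weight

end IsTiltedLogDensity
/-! ### Hausdorff limit of regions obtained by inverting intervals -/

/-- Relevant `θ` lie within `B` of `y`, where eventually both end functions are close to their
limits. No monotonicity of `θ + a θ` or `θ + b θ` is needed. -/
lemma tendsto_hausdorffEDist_inverted_interval {F : Filter ℝ} [F.NeBot] {a b : ℝ → ℝ}
    {l r B : ℝ} (hlr : l < r) (ha : Tendsto a F (𝓝 l)) (hb : Tendsto b F (𝓝 r))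
    (hB : ∀ θ, -B ≤ a θ ∧ b θ ≤ B)
    (hF : ∀ P : ℝ → Prop, (∀ᶠ θ in F, P θ) → ∀ᶠ y in F, ∀ t ∈ Icc (-B) B, P (y + t)) :
    Tendsto (fun y => Metric.hausdorffEDist
      ((fun θ => θ - y) '' {θ | θ + a θ ≤ y ∧ y ≤ θ + b θ}) (Icc (-r) (-l))) F (𝓝 0) := by
  have hl : -B ≤ l := ge_of_tendsto' ha fun θ => (hB θ).1
  have hr : r ≤ B := le_of_tendsto' hb fun θ => (hB θ).2
  refine ENNReal.tendsto_nhds_zero.2 fun ε hε => ?_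
  obtain ⟨e₀, he₀, he₀ε⟩ := ENNReal.lt_iff_exists_nnreal_btwn.1 hε
  -- The cap at half the length keeps the interval `[-r + e, -l - e]` nonempty; all of it lies in
  -- the recentred region for the `y` considered.
  set e : ℝ := min e₀ ((r - l) / 2) with he
  have hepos : 0 < e := lt_min (by exact_mod_cast he₀) (half_pos (sub_pos.2 hlr))
  have he2 : e ≤ (r - l) / 2 := min_le_right _ _
  have heε : ENNReal.ofReal e ≤ ε :=
    (ENNReal.ofReal_le_ofReal (min_le_left _ _)).trans (by simpa using he₀ε.le)
  have hP : ∀ᶠ θ in F, (l - e < a θ ∧ a θ < l + e) ∧ r - e < b θ ∧ b θ < r + e :=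
    ((ha.eventually_const_lt (sub_lt_self l hepos)).and
      (ha.eventually_lt_const (lt_add_of_pos_right l hepos))).and
      ((hb.eventually_const_lt (sub_lt_self r hepos)).and
      (hb.eventually_lt_const (lt_add_of_pos_right r hepos)))
  filter_upwards [hF _ hP] with y hy
  have hedist : ∀ u v : ℝ, |u - v| ≤ e → edist u v ≤ ε := fun u v huv => by
    rw [edist_dist, Real.dist_eq]
    exact (ENNReal.ofReal_le_ofReal huv).trans heε
  refine Metric.hausdorffEDist_le_of_mem_edist ?_ ?_
  · rintro _ ⟨θ, ⟨h1, h2⟩, rfl⟩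
    have h3 := hy (θ - y) ⟨by linarith [(hB θ).2], by linarith [(hB θ).1]⟩
    rw [add_sub_cancel] at h3
    obtain ⟨⟨h4, -⟩, -, h5⟩ := h3
    -- The nearest point of the limit interval.
    refine ⟨max (-r) (min (θ - y) (-l)), ⟨le_max_left _ _, max_le (by linarith)
      (min_le_right _ _)⟩, hedist _ _ ?_⟩
    simp only
    rw [abs_le]
    rcases max_cases (-r) (min (θ - y) (-l)) with h | h <;>
      rcases min_cases (θ - y) (-l) with h' | h' <;> constructor <;> linarith
  · rintro x ⟨h1, h2⟩
    -- Push `x` into the shrunken interval, at a cost of at most `e`.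
    set x' := max (-r + e) (min x (-l - e)) with hx'
    have h3 : -r + e ≤ x' := le_max_left _ _
    have h4 : x' ≤ -l - e := max_le (by linarith) (min_le_right _ _)
    obtain ⟨⟨-, h5⟩, h6, -⟩ := hy x' ⟨by linarith, by linarith⟩
    refine ⟨x', ⟨y + x', ⟨by linarith, by linarith⟩, add_sub_cancel_left _ _⟩, hedist _ _ ?_⟩
    rw [hx', abs_le]
    rcases max_cases (-r + e) (min x (-l - e)) with h | h <;>
      rcases min_cases x (-l - e) with h' | h' <;> constructor <;> linarith

lemma eventually_atTop_forall_add {B : ℝ} (P : ℝ → Prop) (hP : ∀ᶠ θ in atTop, P θ) :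
    ∀ᶠ y in atTop, ∀ t ∈ Icc (-B) B, P (y + t) := by
  obtain ⟨M, hM⟩ := eventually_atTop.1 hP
  filter_upwards [eventually_ge_atTop (M + B)] with y hy t ht
  exact hM _ (by linarith [ht.1])

lemma eventually_atBot_forall_add {B : ℝ} (P : ℝ → Prop) (hP : ∀ᶠ θ in atBot, P θ) :
    ∀ᶠ y in atBot, ∀ t ∈ Icc (-B) B, P (y + t) := by
  obtain ⟨M, hM⟩ := eventually_atBot.1 hP
  filter_upwards [eventually_le_atBot (M - B)] with y hy t ht
  exact hM _ (by linarith [ht.2])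

/-! ### Critical values and confidence regions -/

section Region

variable {σ κ : ℝ} {prior : Measure ℝ}

lemma isTiltedLogDensity_log_fabMarginal (hσ : 0 < σ) (hprior : FabAdmissiblePrior σ prior)
    {γ δ : ℝ} (hγ : 0 < γ)
    (htop : Asymptotics.IsEquivalent atTop (fabMarginal σ prior)
      (fun y => γ * |y| ^ (-δ) * Real.exp (-(κ / σ) * |y|)))
    (hbot : Asymptotics.IsEquivalent atBot (fabMarginal σ prior)
      (fun y => γ * |y| ^ (-δ) * Real.exp (-(κ / σ) * |y|))) :
    IsTiltedLogDensity σ κ (fun y => Real.log (fabMarginal σ prior y))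
      (fabPosteriorMean σ prior) where
  hasDerivAt := hasDerivAt_log_fabMarginal hσ hprior
  tangent_lt _ _ h := log_fabMarginal_tangent_lt hσ hprior h
  tendsto_top h := by
    have := tendsto_log_sub_log_of_isEquivalent (h := h) (ε := 1) hγ htop
      (fabMarginal_pos hσ hprior) tendsto_abs_atTop_atTop
      (tendsto_atTop_add_const_right _ h tendsto_id) (by
        filter_upwards [eventually_ge_atTop 0, eventually_ge_atTop (-h)] with y h1 h2
        rw [abs_of_nonneg h1, abs_of_nonneg (by linarith)]
        ring)
    rwa [one_mul] at this
  tendsto_bot h := by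
    have := tendsto_log_sub_log_of_isEquivalent (h := h) (ε := -1) hγ hbot
      (fabMarginal_pos hσ hprior) tendsto_abs_atBot_atTop
      (tendsto_atBot_add_const_right _ h tendsto_id) (by
        filter_upwards [eventually_le_atBot 0, eventually_le_atBot (-h)] with y h1 h2
        rw [abs_of_nonpos h1, abs_of_nonpos (by linarith)]
        ring)
    rwa [neg_one_mul, neg_mul_neg] at this

lemma fabLogRatio_eq (hσ : 0 < σ) (θ y : ℝ) :
    fabLogRatio σ prior θ y =
      penalizedLog σ (fun y => Real.log (fabMarginal σ prior y)) θ y +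
        Real.log √(2 * Real.pi * σ ^ 2) := by
  rw [fabLogRatio, log_fabLikelihood hσ, penalizedLog]
  ring

variable {m : ℝ → ℝ} {α : ℝ}
  (H : IsTiltedLogDensity σ κ (fun y => Real.log (fabMarginal σ prior y)) m)

include H

lemma setOf_fabLogRatio_le (hσ : 0 < σ) (hα : α ∈ Ioo (0 : ℝ) 1) {θ ω : ℝ}
    (hω : IsBalancedWeight σ (fun y => Real.log (fabMarginal σ prior y)) α θ ω) :
    {y | fabLogRatio σ prior θ y ≤
      fabLogRatio σ prior θ (θ + σ * stdNormalQuantile (α * ω))} =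
      Icc (θ + σ * stdNormalQuantile (α * ω))
        (θ + σ * -stdNormalQuantile (α * (1 - ω))) := by
  rw [← (H.strictConvexOn_penalizedLog hσ θ).setOf_le_eq_Icc (add_lt_add_right
    (mul_lt_mul_of_pos_left (stdNormalQuantile_mul_lt_neg hα hω.mem) hσ) θ) hω.eq]
  simp only [fabLogRatio_eq hσ, add_le_add_iff_right]

/-- The two tails have mass `αω` and `α(1 - ω)`, so the level is exact. Below it, continuity
excludes a strip at the left end, which lowers the acceptance probability strictly. -/
lemma isLeast_fabExactLevels (hσ : 0 < σ) (hα : α ∈ Ioo (0 : ℝ) 1) {θ ω : ℝ}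
    (hω : IsBalancedWeight σ (fun y => Real.log (fabMarginal σ prior y)) α θ ω) :
    IsLeast (fabExactLevels σ prior α θ)
      (fabLogRatio σ prior θ (θ + σ * stdNormalQuantile (α * ω))) := by
  set a := stdNormalQuantile (α * ω) with ha
  set b := -stdNormalQuantile (α * (1 - ω)) with hb
  have hset := setOf_fabLogRatio_le H hσ hα hω
  have hΦa : stdNormalCdf a = α * ω :=
    stdNormalCdf_stdNormalQuantile (mul_mem_Ioo_zero_one hα hω.mem)
  have hΦb : stdNormalCdf b = 1 - α * (1 - ω) := by
    rw [hb, stdNormalCdf_neg, stdNormalCdf_stdNormalQuantile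
      (mul_mem_Ioo_zero_one hα (one_sub_mem_Ioo hω.mem))]
  refine ⟨?_, fun k hk => ?_⟩
  · rw [fabExactLevels, mem_ofPred_eq, hset, gaussianReal_fabVar_Icc hσ, hΦa, hΦb]
    congr 1
    ring
  · by_contra! hlt
    have hcont : Continuous fun z => fabLogRatio σ prior θ (θ + σ * z) := by
      have h1 := H.continuous_penalizedLog θ
      simp only [fabLogRatio_eq hσ]
      fun_prop
    obtain ⟨e, he, hball⟩ := Metric.eventually_nhds_iff.1
      (hcont.continuousAt.tendsto.eventually_const_lt hlt)
    have hsub : {y | fabLogRatio σ prior θ y ≤ k} ⊆ Icc (θ + σ * (a + e)) (θ + σ * b) := by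
      intro y hy
      have hy' : y ∈ Icc (θ + σ * a) (θ + σ * b) := by
        rw [← hset]
        exact le_trans hy hlt.le
      refine ⟨?_, hy'.2⟩
      by_contra! hn
      have hz : θ + σ * ((y - θ) / σ) = y := by field_simp; ring
      have h1 : a ≤ (y - θ) / σ := by rw [le_div_iff₀ hσ]; linarith [hy'.1]
      have h2 : (y - θ) / σ < a + e := by rw [div_lt_iff₀ hσ]; linarith
      have h3 := hball (y := (y - θ) / σ)
        (by rw [Real.dist_eq, abs_of_nonneg (by linarith)]; linarith)
      rw [hz] at h3
      exact absurd hy (not_le.2 h3)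
    have hle := measure_mono (μ := gaussianReal θ (fabVar σ)) hsub
    rw [show gaussianReal θ (fabVar σ) {y | fabLogRatio σ prior θ y ≤ k} =
      ENNReal.ofReal (1 - α) from hk, gaussianReal_fabVar_Icc hσ] at hle
    have hΦ := strictMono_stdNormalCdf (lt_add_of_pos_right a he)
    refine hle.not_gt ((ENNReal.ofReal_lt_ofReal_iff (sub_pos.2 hα.2)).2 ?_)
    nlinarith

lemma isLeast_fabCritical (hσ : 0 < σ) (hα : α ∈ Ioo (0 : ℝ) 1) (θ : ℝ) :
    IsLeast (fabExactLevels σ prior α θ) (fabCritical σ prior α θ) := by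
  obtain ⟨ω, hω⟩ := H.exists_isBalancedWeight hσ hα θ
  have h := isLeast_fabExactLevels H hσ hα hω
  rwa [fabCritical, h.csInf_eq]

lemma fabRegion_eq (hσ : 0 < σ) (hα : α ∈ Ioo (0 : ℝ) 1) {W : ℝ → ℝ}
    (hW : ∀ θ, IsBalancedWeight σ (fun y => Real.log (fabMarginal σ prior y)) α θ (W θ)) (y : ℝ) :
    fabRegion σ prior α y = {θ | θ + σ * stdNormalQuantile (α * W θ) ≤ y ∧
      y ≤ θ + σ * -stdNormalQuantile (α * (1 - W θ))} := by
  ext θ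
  have h := setOf_fabLogRatio_le H hσ hα (hW θ)
  rw [← (isLeast_fabExactLevels H hσ hα (hW θ)).csInf_eq] at h
  exact Set.ext_iff.1 h y

lemma exists_fabRegion_bound (hσ : 0 < σ) (hα : α ∈ Ioo (0 : ℝ) 1) :
    ∃ B : ℝ, ∀ y, fabRegion σ prior α y ⊆ Icc (y - B) (y + B) := by
  choose W hW using H.exists_isBalancedWeight hσ hα
  obtain ⟨B, hB⟩ := H.exists_endpoint_bound hσ hα hW
  refine ⟨B, fun y θ hθ => ?_⟩
  rw [fabRegion_eq H hσ hα hW] at hθ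
  exact ⟨by linarith [hθ.2, (hB θ).2], by linarith [hθ.1, (hB θ).1]⟩

lemma isClosed_fabRegion (hσ : 0 < σ) (hα : α ∈ Ioo (0 : ℝ) 1) (y : ℝ) :
    IsClosed (fabRegion σ prior α y) := by
  choose W hW using H.exists_isBalancedWeight hσ hα
  rw [fabRegion_eq H hσ hα hW]
  exact (isClosed_le (continuous_id.add (H.continuous_lower hσ hα hW)) continuous_const).inter
    (isClosed_le continuous_const (continuous_id.add (H.continuous_upper hσ hα hW)))

lemma exists_volume_fabRegion_le (hσ : 0 < σ) (hα : α ∈ Ioo (0 : ℝ) 1) :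
    ∃ B : ℝ≥0, ∀ y, volume (fabRegion σ prior α y) ≤ B := by
  obtain ⟨B, hB⟩ := exists_fabRegion_bound H hσ hα
  refine ⟨(2 * B).toNNReal, fun y => (measure_mono (hB y)).trans ?_⟩
  rw [Real.volume_Icc, show y + B - (y - B) = 2 * B by ring]
  exact le_rfl

/-- Both tails are instances: `ω₀ = 1 - c_α` at `+∞` and `ω₀ = c_α` at `-∞`. The limit is assumed
for every balanced `W` because `W` is chosen inside the proof. -/
lemma tendsto_hausdorffEDist_fabCenteredRegion (hσ : 0 < σ) (hα : α ∈ Ioo (0 : ℝ) 1)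
    {F : Filter ℝ} [F.NeBot] {ω₀ : ℝ} (h0 : ω₀ ∈ Ioo (0 : ℝ) 1)
    (hlim : ∀ W : ℝ → ℝ,
      (∀ θ, IsBalancedWeight σ (fun y => Real.log (fabMarginal σ prior y)) α θ (W θ)) →
        Tendsto W F (𝓝 ω₀))
    (hF : ∀ (B : ℝ) (P : ℝ → Prop), (∀ᶠ θ in F, P θ) →
      ∀ᶠ y in F, ∀ t ∈ Icc (-B) B, P (y + t)) :
    Tendsto (fun y => Metric.hausdorffEDist (fabCenteredRegion σ prior α y)
      (Icc (-(σ * stdNormalQuantile (1 - α * (1 - ω₀))))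
        (σ * stdNormalQuantile (1 - α * ω₀)))) F (𝓝 0) := by
  choose W hW using H.exists_isBalancedWeight hσ hα
  obtain ⟨B, hB⟩ := H.exists_endpoint_bound hσ hα hW
  have h := tendsto_hausdorffEDist_inverted_interval
    (mul_lt_mul_of_pos_left (stdNormalQuantile_mul_lt_neg hα h0) hσ)
    (IsTiltedLogDensity.tendsto_lower hα h0 (hlim W hW))
    (IsTiltedLogDensity.tendsto_upper hα h0 (hlim W hW)) hB (hF B)
  rw [stdNormalQuantile_one_sub (mul_mem_Ioo_zero_one hα (one_sub_mem_Ioo h0)),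
    stdNormalQuantile_one_sub (mul_mem_Ioo_zero_one hα h0), mul_neg σ (stdNormalQuantile (α * ω₀))]
  simpa only [fabCenteredRegion, fabRegion_eq H hσ hα hW] using h

/-! ### The focal point -/

lemma antitoneOn_fabCritical (hσ : 0 < σ) (θ : ℝ) :
    AntitoneOn (fun α => fabCritical σ prior α θ) (Ioo 0 1) := by
  intro α hα β hβ hαβ
  have h1 : gaussianReal θ (fabVar σ)
      {y | fabLogRatio σ prior θ y ≤ fabCritical σ prior α θ} = ENNReal.ofReal (1 - α) :=
    (isLeast_fabCritical H hσ hα θ).1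
  have h2 : gaussianReal θ (fabVar σ)
      {y | fabLogRatio σ prior θ y ≤ fabCritical σ prior β θ} = ENNReal.ofReal (1 - β) :=
    (isLeast_fabCritical H hσ hβ θ).1
  by_contra! hlt
  have h3 := measure_mono (μ := gaussianReal θ (fabVar σ))
    (show {y | fabLogRatio σ prior θ y ≤ fabCritical σ prior α θ} ⊆
      {y | fabLogRatio σ prior θ y ≤ fabCritical σ prior β θ} from
      fun y hy => le_trans hy hlt.le)
  rw [h1, h2, ENNReal.ofReal_le_ofReal_iff (sub_nonneg.2 hβ.2.le)] at h3
  have hαβ' : α = β := by linarith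
  exact hlt.ne (by rw [hαβ'])

lemma fabRegion_subset (hσ : 0 < σ) {β : ℝ} (hα : α ∈ Ioo (0 : ℝ) 1) (hβ : β ∈ Ioo (0 : ℝ) 1)
    (hαβ : α ≤ β) (y : ℝ) : fabRegion σ prior β y ⊆ fabRegion σ prior α y := fun θ hθ =>
  le_trans (show fabLogRatio σ prior θ y ≤ _ from hθ) (antitoneOn_fabCritical H hσ θ hα hβ hαβ)

/-- If `y` does not minimise `λ_θ`, the points with smaller ratio form a nonempty open set contained
in every acceptance region of `θ`, although these have mass `1 - α → 0`. If `y` does minimise it,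
rejecting `y` would leave an empty acceptance region of mass `1 - α > 0`. -/
lemma iInter_fabRegion (hσ : 0 < σ) (y : ℝ) :
    ⋂ α ∈ Ioo (0 : ℝ) 1, fabRegion σ prior α y = {m y} := by
  ext θ
  rw [mem_iInter₂, mem_singleton_iff, ← H.forall_penalizedLog_le_iff hσ]
  constructor
  · intro h
    by_contra! hn
    obtain ⟨z, hz⟩ := hn
    set U := {x | penalizedLog σ (fun y => Real.log (fabMarginal σ prior y)) θ x <
      penalizedLog σ (fun y => Real.log (fabMarginal σ prior y)) θ y}
    have hU : IsOpen U := isOpen_lt (H.continuous_penalizedLog θ) continuous_const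
    have hUpos : 0 < gaussianReal θ (fabVar σ) U := by
      refine pos_iff_ne_zero.2 fun h0 => ?_
      exact (hU.measure_pos volume ⟨z, hz⟩).ne'
        (gaussianReal_absolutelyContinuous' θ (fabVar_ne_zero hσ) h0)
    have hle : ∀ α ∈ Ioo (0 : ℝ) 1, gaussianReal θ (fabVar σ) U ≤ ENNReal.ofReal (1 - α) := by
      intro α hα
      rw [← show gaussianReal θ (fabVar σ)
        {y | fabLogRatio σ prior θ y ≤ fabCritical σ prior α θ} = ENNReal.ofReal (1 - α) from
        (isLeast_fabCritical H hσ hα θ).1]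
      refine measure_mono fun x hx => ?_
      have h1 : fabLogRatio σ prior θ y ≤ fabCritical σ prior α θ := h α hα
      refine le_trans ?_ h1
      rw [fabLogRatio_eq hσ, fabLogRatio_eq hσ]
      exact add_le_add_left (le_of_lt hx) _
    have hlim : Tendsto (fun α : ℝ => ENNReal.ofReal (1 - α)) (𝓝[<] 1) (𝓝 0) := by
      have h1 : Continuous fun α : ℝ => ENNReal.ofReal (1 - α) :=
        ENNReal.continuous_ofReal.comp (by fun_prop)
      have h2 := h1.tendsto 1
      rw [sub_self, ENNReal.ofReal_zero] at h2
      exact h2.mono_left nhdsWithin_le_nhds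
    refine hUpos.not_ge (ge_of_tendsto hlim ?_)
    filter_upwards [Ioo_mem_nhdsLT (zero_lt_one' ℝ)] with α hα using hle α hα
  · intro h α hα
    by_contra hn
    have hlt : fabCritical σ prior α θ < fabLogRatio σ prior θ y := not_le.1 hn
    have h1 : gaussianReal θ (fabVar σ)
        {y | fabLogRatio σ prior θ y ≤ fabCritical σ prior α θ} = ENNReal.ofReal (1 - α) :=
      (isLeast_fabCritical H hσ hα θ).1
    have h2 : {y | fabLogRatio σ prior θ y ≤ fabCritical σ prior α θ} = ∅ := by
      refine eq_empty_of_forall_notMem fun z hz => ?_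
      have h3 := lt_of_le_of_lt hz hlt
      rw [fabLogRatio_eq hσ, fabLogRatio_eq hσ, add_lt_add_iff_right] at h3
      exact absurd (h z) (not_le.2 h3)
    rw [h2, measure_empty, eq_comm, ENNReal.ofReal_eq_zero] at h1
    linarith [hα.2]

lemma tendsto_volume_fabRegion (hσ : 0 < σ) (y : ℝ) :
    Tendsto (fun α => volume (fabRegion σ prior α y)) (𝓝[<] 1) (𝓝 0) := by
  -- Continuity from above in `r = 1 - α`. The value `univ` for `r ≥ 1` makes the family monotone
  -- over all `r > 0`; finiteness of the volume is checked at `r = 1/2`.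
  let s : ℝ → Set ℝ := fun r => if r < 1 then fabRegion σ prior (1 - r) y else univ
  have hmem : ∀ {r : ℝ}, 0 < r → r < 1 → 1 - r ∈ Ioo (0 : ℝ) 1 := fun h0 h1 =>
    one_sub_mem_Ioo ⟨h0, h1⟩
  have hs : ∀ r, r < 1 → s r = fabRegion σ prior (1 - r) y := fun r hr => if_pos hr
  have hs' : ∀ r, ¬ r < 1 → s r = univ := fun r hr => if_neg hr
  have hlim : Tendsto (volume ∘ s) (𝓝[>] 0) (𝓝 (volume (⋂ r > 0, s r))) := by
    refine tendsto_measure_biInter_gt (fun r hr => ?_) (fun i j hi hij => ?_) ⟨1 / 2, by norm_num, ?_⟩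
    · by_cases h : r < 1
      · rw [hs r h]
        exact (isClosed_fabRegion H hσ (hmem hr h) y).measurableSet.nullMeasurableSet
      · rw [hs' r h]
        exact MeasurableSet.univ.nullMeasurableSet
    · by_cases h : j < 1
      · rw [hs j h, hs i (hij.trans_lt h)]
        exact fabRegion_subset H hσ (hmem (hi.trans_le hij) h) (hmem hi (hij.trans_lt h))
          (sub_le_sub_left hij 1) y
      · rw [hs' j h]
        exact subset_univ _
    · rw [hs _ (by norm_num)]
      obtain ⟨B, hB⟩ := exists_volume_fabRegion_le H hσ (α := 1 - 1 / 2) (by norm_num)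
      exact ((hB y).trans_lt ENNReal.coe_lt_top).ne
  have hzero : volume (⋂ r > 0, s r) = 0 := by
    refine measure_mono_null (t := {m y}) ?_ (measure_singleton _)
    rw [← iInter_fabRegion H hσ y]
    refine subset_iInter₂ fun α hα => ?_
    refine (iInter₂_subset (1 - α) (sub_pos.2 hα.2)).trans ?_
    rw [hs _ (by linarith [hα.1]), sub_sub_cancel]
  rw [hzero] at hlim
  have hsub : Tendsto (fun α : ℝ => 1 - α) (𝓝[<] 1) (𝓝[>] 0) := by
    refine tendsto_nhdsWithin_iff.2 ⟨?_, ?_⟩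
    · have h1 : Continuous fun α : ℝ => 1 - α := by fun_prop
      have h2 := h1.tendsto 1
      rw [sub_self] at h2
      exact h2.mono_left nhdsWithin_le_nhds
    · filter_upwards [self_mem_nhdsWithin] with α hα using sub_pos.2 (mem_Iio.1 hα)
  refine (hlim.comp hsub).congr' ?_
  filter_upwards [Ioo_mem_nhdsLT (zero_lt_one' ℝ)] with α hα
  rw [Function.comp, Function.comp, hs _ (by linarith [hα.1]), sub_sub_cancel]

end Region

end

theorem theorem3p4
    (σ : ℝ) (hσ : 0 < σ)
    (prior : Measure ℝ) (hprior : FabAdmissiblePrior σ prior)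
    (γ δ κ : ℝ) (hγ : 0 < γ) (hδ : 0 ≤ δ) (hκ : 0 ≤ κ)
    (htail_top : Asymptotics.IsEquivalent atTop (fabMarginal σ prior)
      (fun y => γ * |y| ^ (-δ) * Real.exp (-(κ / σ) * |y|)))
    (htail_bot : Asymptotics.IsEquivalent atBot (fabMarginal σ prior)
      (fun y => γ * |y| ^ (-δ) * Real.exp (-(κ / σ) * |y|)))
    (hmono_top : ∃ M : ℝ,
      MonotoneOn (deriv fun y => fabMarginal σ prior y * Real.exp (κ * |y| / σ)) (Ioi M) ∨
      AntitoneOn (deriv fun y => fabMarginal σ prior y * Real.exp (κ * |y| / σ)) (Ioi M))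
    (hmono_bot : ∃ M : ℝ,
      MonotoneOn (deriv fun y => fabMarginal σ prior y * Real.exp (κ * |y| / σ)) (Iio M) ∨
      AntitoneOn (deriv fun y => fabMarginal σ prior y * Real.exp (κ * |y| / σ)) (Iio M))
    (α : ℝ) (hα : α ∈ Ioo (0 : ℝ) 1) :
    -- the critical values exist, and the regions are closed
    (∀ θ₀ : ℝ, IsLeast (fabExactLevels σ prior α θ₀) (fabCritical σ prior α θ₀)) ∧
    (∀ y : ℝ, IsClosed (fabRegion σ prior α y)) ∧
    -- uniformly bounded volume
    (∃ B : ℝ≥0, ∀ y : ℝ, volume (fabRegion σ prior α y) ≤ B) ∧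
    -- the function that defines the limiting weight, and the location of that weight
    StrictMonoOn (fabG α) (Ioo 0 1) ∧
    BijOn (fabG α) (Ioo 0 1) univ ∧
    0 < fabLimitWeight α κ ∧
    fabLimitWeight α κ ≤ stdNormalCdf (-κ) ∧
    (0 < κ → fabLimitWeight α κ < stdNormalCdf (-κ)) ∧
    -- limits of the recentred regions in Hausdorff distance
    Tendsto (fun y => Metric.hausdorffEDist (fabCenteredRegion σ prior α y)
      (Icc (-(σ * stdNormalQuantile (1 - α * fabLimitWeight α κ)))
        (σ * stdNormalQuantile (1 - α * (1 - fabLimitWeight α κ))))) atTop (𝓝 0) ∧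
    Tendsto (fun y => Metric.hausdorffEDist (fabCenteredRegion σ prior α y)
      (Icc (-(σ * stdNormalQuantile (1 - α * (1 - fabLimitWeight α κ))))
        (σ * stdNormalQuantile (1 - α * fabLimitWeight α κ)))) atBot (𝓝 0) ∧
    -- the focal point is the posterior mean, and its asymptotic offset
    (∃ focal : ℝ → ℝ,
      (∀ y : ℝ, IsFabFocalPoint σ prior y (focal y)) ∧
      (∀ y : ℝ, focal y = fabPosteriorMean σ prior y) ∧
      Tendsto (fun y => y - focal y) atTop (𝓝 (σ * κ)) ∧
      Tendsto (fun y => focal y - y) atBot (𝓝 (σ * κ))) := by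
  have H := isTiltedLogDensity_log_fabMarginal hσ hprior hγ htail_top htail_bot
  have hc := fabLimitWeight_mem hα κ
  refine ⟨isLeast_fabCritical H hσ hα, isClosed_fabRegion H hσ hα,
    exists_volume_fabRegion_le H hσ hα, strictMonoOn_fabG hα, bijOn_fabG hα, hc.1,
    fabLimitWeight_le hα hκ, fabLimitWeight_lt hα, ?_, ?_, fabPosteriorMean σ prior,
    fun y => ⟨tendsto_volume_fabRegion H hσ y, iInter_fabRegion H hσ y⟩, fun _ => rfl,
    H.tendsto_sub_mean_atTop hσ, H.tendsto_mean_sub_atBot hσ⟩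
  · have h := tendsto_hausdorffEDist_fabCenteredRegion H hσ hα (one_sub_mem_Ioo hc)
      (fun W hW => H.tendsto_weight_atTop hσ hα hW) fun _ => eventually_atTop_forall_add
    rwa [sub_sub_cancel] at h
  · exact tendsto_hausdorffEDist_fabCenteredRegion H hσ hα hc
      (fun W hW => H.tendsto_weight_atBot hσ hα hW) fun _ => eventually_atBot_forall_add
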